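/- Let $\tilde{\mathcal A}$ be the $\mathbb C$-algebra of series $\sum_{\nu\ge 0}P_\nu(a)b^\nu$, $P_\nu\in\mathbb C[x]$, with $ab-ba=b^2$ and with left and right multiplication by $a$ continuous for the $b$-adic filtration. For a finite set $\Lambda\subset\mathbb Q\cap\,]0,1]$ and $N\in\mathbb N$ let $\Xi^{(N)}_\Lambda=\bigoplus_{\lambda\in\Lambda}\bigoplus_{j=0}^N\mathbb C[[b]]\,s^{\lambda-1}(\operatorname{Log}s)^j$ be the left $\tilde{\mathcal A}$-module of formal asymptotic expansions, where $a$ is multiplication by $s$ and $b$ is the primitive in $s$ without constant. A *fresco* is a left $\tilde{\mathcal A}$-module isomorphic to $\tilde{\mathcal A}\varphi\subset\Xi^{(N)}_\Lambda\otimes_{\mathbb C}V$ for some $\Lambda$, $N$, some finite dimensional complex vector space $V$ and some $\varphi$; it is free of finite rank over $\mathbb C[[b]]$. The Bernstein polynomial of a fresco $E$ is the minimal polynomial of $-b^{-1}a$ on $E^\sharp/bE^\sharp$, where $E^\sharp\subset E[b^{-1}]$ is the saturation of $E$ by $b^{-1}a$. For $\lambda\in\mathbb Q\cap\,]0,1]$,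 $E$ is *$[\lambda]$-primitive* when all roots of this polynomial lie in $-\lambda+\mathbb Z$. For $\mu\in\mathbb C$ put $E_\mu=\tilde{\mathcal A}/\tilde{\mathcal A}(a-\mu b)$. A submodule $F\subset E$ is *normal* when $F\cap bE=bF$. A *Jordan–Hölder sequence* of $E$, of rank $k$, is a sequence $0=F_0\subset F_1\subset\dots\subset F_k=E$ of normal $\tilde{\mathcal A}$-submodules such that every $F_j/F_{j-1}$ has rank $1$ over $\mathbb C[[b]]$. It is *principal* when $F_j/F_{j-1}\simeq E_{\lambda_j}$ for $j=1,\dots,k$ with real numbers $\lambda_j$ such that $j\mapsto\lambda_j+j$ is non-decreasing. **Proposition.** Let $\lambda\in\mathbb Q\cap\,]0,1]$ and let $E$ be a $[\lambda]$-primitive fresco of rank $k$. Then $E$ has exactly one principal Jordan–Hölder sequence $(F_j)_{0\le j\le k}$. There is exactly one $k$-tuple $(\lambda_1,\dots,\lambda_k)$ of complex numbers with $F_j/F_{j-1}\simeq E_{\lambda_j}$ for all $j$ (the *fundamental invariants* of $E$), and $\lambda_j\in\lambda+\mathbb N$ for all $j$. If $\varphi:E\to E'$ is an isomorphism of $\tilde{\mathcal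 A}$-modules, then $(\varphi(F_j))_{0\le j\le k}$ is the unique principal Jordan–Hölder sequence $(F'_j)_{0\le j\le k}$ of $E'$; consequently $E$ and $E'$ have the same fundamental invariants, and $F_j/F_{i-1}\simeq F'_j/F'_{i-1}$ for $1\le i\le j\le k$. So the fundamental invariants and the isomorphism classes of the subquotients $F_j/F_{i-1}$ depend only on the isomorphism class of $E$. -/

import Mathlib

open PowerSeries
open scoped Pointwise

universe u v

noncomputable section

/-- A left module `E` over the subalgebra `ℂ[[b]]` (here `b = X`) with an operator `a` such that
`a S = S a + b² S'` for every `S ∈ ℂ[[b]]`. Taking `S` constant shows that `a` is `ℂ`-linear and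
taking `S = b` gives `a b - b a = b²`. When `E` is finitely generated over `ℂ[[b]]` this is the same
as a left module over the `b`-adically completed algebra `Ã` of series `∑ P_ν(a) b^ν`. -/
class ABStructure (E : Type u) [AddCommGroup E] [Module ℂ⟦X⟧ E] where
  a : E →+ E
  a_smul : ∀ (S : ℂ⟦X⟧) (x : E), a (S • x) = S • a x + (X ^ 2 * derivative ℂ S) • x

namespace ABStructure

/-- `Ã`-submodules: `ℂ[[b]]`-submodules stable by `a`. -/
@[ext]
structure Sub (E : Type u) [AddCommGroup E] [Module ℂ⟦X⟧ E] [ABStructure E] where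
  carrier : Submodule ℂ⟦X⟧ E
  a_mem : ∀ x ∈ carrier, a x ∈ carrier

/-- Isomorphisms of `Ã`-modules: `ℂ[[b]]`-linear isomorphisms commuting with `a`. -/
structure Iso (E : Type u) (E' : Type v) [AddCommGroup E] [Module ℂ⟦X⟧ E] [ABStructure E]
    [AddCommGroup E'] [Module ℂ⟦X⟧ E'] [ABStructure E'] extends E ≃ₗ[ℂ⟦X⟧] E' where
  map_a : ∀ x : E, toLinearEquiv (a x) = a (toLinearEquiv x)

section Constructions

variable {E : Type u} [AddCommGroup E] [Module ℂ⟦X⟧ E] [ABStructure E]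
variable {E' : Type v} [AddCommGroup E'] [Module ℂ⟦X⟧ E'] [ABStructure E']

/-- The structure induced on a submodule. -/
instance (F : Sub E) : ABStructure F.carrier where
  a := { toFun := fun x => ⟨a x.1, F.a_mem x.1 x.2⟩
         map_zero' := by ext; simp
         map_add' := fun x y => by ext; simp }
  a_smul S x := by ext; simp [a_smul]

/-- The structure induced on a quotient. -/
instance (F : Sub E) : ABStructure (E ⧸ F.carrier) where
  a := QuotientAddGroup.map F.carrier.toAddSubgroup F.carrier.toAddSubgroup a F.a_mem
  a_smul S x := by
    obtain ⟨x, rfl⟩ := Submodule.Quotient.mk_surjective _ x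
    exact congrArg (Submodule.Quotient.mk (p := F.carrier)) (a_smul S x)

/-- `Ã.φ`, the smallest `Ã`-submodule containing `φ`. -/
def cyclic (φ : E) : Sub E where
  carrier := sInf {M | φ ∈ M ∧ ∀ x ∈ M, a x ∈ M}
  a_mem x hx := by
    rw [Submodule.mem_sInf] at hx ⊢
    exact fun M hM => hM.2 x (hx M hM)

/-- `F ∩ G` regarded as a submodule of `G` (it is `F` itself when `F ⊆ G`). -/
def Sub.restrict (F G : Sub E) : Sub G.carrier where
  carrier := F.carrier.comap G.carrier.subtype
  a_mem x hx := F.a_mem x.1 hx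

/-- The subquotient `G / F`, for `F ⊆ G`. -/
abbrev Subquotient (G F : Sub E) : Type u := G.carrier ⧸ (F.restrict G).carrier

/-- The image of a submodule under an isomorphism. -/
def Sub.map (φ : Iso E E') (F : Sub E) : Sub E' where
  carrier := F.carrier.map (φ.toLinearEquiv : E →ₗ[ℂ⟦X⟧] E')
  a_mem := by
    rintro _ ⟨x, hx, rfl⟩
    exact ⟨a x, F.a_mem x hx, φ.map_a x⟩

/-- `F` is normal in `E` when `F ∩ bE = bF`. -/
def Sub.IsNormal (F : Sub E) : Prop :=
  F.carrier ⊓ (X : ℂ⟦X⟧) • (⊤ : Submodule ℂ⟦X⟧ E) = (X : ℂ⟦X⟧) • F.carrier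

end Constructions

/-! ### Formal asymptotic expansions and frescos -/

/-- `Ξ_Λ^(N) ⊗ V`, for a finite set `Λ` of rational numbers and `V` of dimension `d` with a chosen
basis, as the free `ℂ[[b]]`-module on the elements `s^(l-1) (Log s)^j ⊗ v_i` with `l ∈ Λ`,
`0 ≤ j ≤ N` and `1 ≤ i ≤ d`; the function records the coefficients in this basis. -/
def Xi (Λ : Finset ℚ) (N d : ℕ) : Type := Λ → Fin (N + 1) → Fin d → ℂ⟦X⟧

instance (Λ : Finset ℚ) (N d : ℕ) : AddCommGroup (Xi Λ N d) :=
  inferInstanceAs (AddCommGroup (Λ → Fin (N + 1) → Fin d → ℂ⟦X⟧))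

instance (Λ : Finset ℚ) (N d : ℕ) : Module ℂ⟦X⟧ (Xi Λ N d) :=
  inferInstanceAs (Module ℂ⟦X⟧ (Λ → Fin (N + 1) → Fin d → ℂ⟦X⟧))

/-- The coefficient of index `j + 1`, which is `0` for `j = N`. -/
def Xi.next {Λ : Finset ℚ} {N d : ℕ} (f : Xi Λ N d) (l : Λ) (j : Fin (N + 1))
    (i : Fin d) : ℂ⟦X⟧ :=
  if h : (j : ℕ) + 1 < N + 1 then f l ⟨j + 1, h⟩ i else 0

/-- With `b` the primitive in `s` without constant and `a` the multiplication by `s`, the element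
`e_j = s^(l-1) (Log s)^j` satisfies `a e_j = s^l (Log s)^j = b (l e_j + j e_(j-1))`, since the
derivative of `s^l (Log s)^j` is `l s^(l-1) (Log s)^j + j s^(l-1) (Log s)^(j-1)`. Hence
`a (∑ S_j e_j) = ∑ (b² S_j' + l b S_j + (j+1) b S_(j+1)) e_j`. -/
def Xi.aFun {Λ : Finset ℚ} {N d : ℕ} (f : Xi Λ N d) : Xi Λ N d := fun l j i =>
  X ^ 2 * derivative ℂ (f l j i) + C ((l : ℚ) : ℂ) * (X * f l j i)
    + C ((j : ℂ) + 1) * (X * f.next l j i)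

theorem Xi.aFun_add {Λ : Finset ℚ} {N d : ℕ} (f g : Xi Λ N d) :
    (f + g).aFun = f.aFun + g.aFun := by
  funext l j i
  have h0 : ∀ (f g : Xi Λ N d) l j i, (f + g) l j i = f l j i + g l j i :=
    fun _ _ _ _ _ => rfl
  simp only [h0, Xi.aFun, Xi.next, map_add]
  split_ifs <;> ring

theorem Xi.aFun_smul {Λ : Finset ℚ} {N d : ℕ} (S : ℂ⟦X⟧) (f : Xi Λ N d) :
    (S • f).aFun = S • f.aFun + (X ^ 2 * derivative ℂ S) • f := by
  funext l j i
  have h0 : ∀ (f g : Xi Λ N d) l j i, (f + g) l j i = f l j i + g l j i :=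
    fun _ _ _ _ _ => rfl
  have h1 : ∀ (S : ℂ⟦X⟧) (f : Xi Λ N d) l j i, (S • f) l j i = S * f l j i :=
    fun _ _ _ _ _ => rfl
  simp only [h0, h1, Xi.aFun, Xi.next, Derivation.leibniz, smul_eq_mul]
  split_ifs <;> ring

instance (Λ : Finset ℚ) (N d : ℕ) : ABStructure (Xi Λ N d) where
  a := AddMonoidHom.mk' Xi.aFun Xi.aFun_add
  a_smul := Xi.aFun_smul

/-- A fresco is an `Ã`-module isomorphic to `Ã.φ ⊆ Ξ_Λ^(N) ⊗ V` for some finite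
`Λ ⊆ ℚ ∩ ]0,1]`, some `N`, some finite dimensional `V` and some `φ`. -/
def IsFresco (E : Type u) [AddCommGroup E] [Module ℂ⟦X⟧ E] [ABStructure E] : Prop :=
  ∃ (Λ : Finset ℚ) (N d : ℕ) (φ : Xi Λ N d),
    (∀ l ∈ Λ, 0 < l ∧ l ≤ 1) ∧ Nonempty (Iso E (cyclic φ).carrier)

/-! ### The Bernstein polynomial and primitive modules -/

section Bernstein

variable (E : Type u) [AddCommGroup E] [Module ℂ⟦X⟧ E] [ABStructure E]

/-- The localization `E[b⁻¹]`. -/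
abbrev Loc : Type u := LocalizedModule (Submonoid.powers (X : ℂ⟦X⟧)) E

/-- `b` as a denominator. -/
def bDen : Submonoid.powers (X : ℂ⟦X⟧) := ⟨X, Submonoid.mem_powers X⟩

variable {E} in
/-- `b⁻¹ a (x / s) = a x / (b s) - b s' x / s²`, on representatives. -/
def thetaAux (p : E × Submonoid.powers (X : ℂ⟦X⟧)) : Loc E :=
  LocalizedModule.mk (a p.1) (bDen * p.2)
    - LocalizedModule.mk ((X * derivative ℂ (p.2 : ℂ⟦X⟧)) • p.1) (p.2 * p.2)

variable {E} in
theorem thetaAux_expand (x : E) (s v : Submonoid.powers (X : ℂ⟦X⟧)) :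
    thetaAux (v • x, v * s) = thetaAux (x, s) := by
  have e1 : LocalizedModule.mk (a (v • x)) (bDen * (v * s)) =
      LocalizedModule.mk (a x) (bDen * s)
        + LocalizedModule.mk ((X * derivative ℂ (v : ℂ⟦X⟧)) • x) (v * s) := by
    rw [LocalizedModule.mk_add_mk, LocalizedModule.mk_eq]
    refine ⟨1, ?_⟩
    simp only [Submonoid.smul_def, a_smul, smul_add, smul_smul, Submonoid.coe_mul,
      Submonoid.coe_one, bDen]
    congr 2 <;> ring
  have e2 : LocalizedModule.mk ((X * derivative ℂ ((v * s : Submonoid.powers (X : ℂ⟦X⟧)) : ℂ⟦X⟧))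
        • v • x) (v * s * (v * s)) =
      LocalizedModule.mk ((X * derivative ℂ (s : ℂ⟦X⟧)) • x) (s * s)
        + LocalizedModule.mk ((X * derivative ℂ (v : ℂ⟦X⟧)) • x) (v * s) := by
    rw [LocalizedModule.mk_add_mk, LocalizedModule.mk_eq]
    refine ⟨1, ?_⟩
    simp only [Submonoid.smul_def, smul_smul, Submonoid.coe_mul, Submonoid.coe_one, ← add_smul,
      Derivation.leibniz, smul_eq_mul]
    congr 1
    ring
  simp only [thetaAux, e1, e2]
  abel

variable {E} in
theorem thetaAux_congr (p q : E × Submonoid.powers (X : ℂ⟦X⟧)) (h : p ≈ q) :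
    thetaAux p = thetaAux q := by
  obtain ⟨x, s⟩ := p
  obtain ⟨y, t⟩ := q
  obtain ⟨w, hw⟩ := h
  simp only at hw
  rw [← thetaAux_expand x s (w * t), ← thetaAux_expand y t (w * s), mul_smul, mul_smul, hw,
    show w * t * s = w * s * t by rw [mul_assoc, mul_comm t s, mul_assoc]]

/-- The operator `b⁻¹ a` on `E[b⁻¹]`. -/
def theta : Loc E →+ Loc E :=
  AddMonoidHom.mk' (fun z => z.liftOn thetaAux thetaAux_congr) (by
    intro z w
    induction z using LocalizedModule.induction_on with | h x s => ?_
    induction w using LocalizedModule.induction_on with | h y t => ?_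
    rw [LocalizedModule.mk_add_mk]
    simp only [LocalizedModule.liftOn_mk]
    rw [← thetaAux_expand x s t, ← thetaAux_expand y t s, mul_comm t s]
    simp only [thetaAux, map_add, smul_add]
    have h : ∀ (m n : E) (r : Submonoid.powers (X : ℂ⟦X⟧)),
        LocalizedModule.mk (m + n) r = LocalizedModule.mk m r + LocalizedModule.mk n r := by
      intro m n r
      rw [LocalizedModule.mk_add_mk, ← smul_add, LocalizedModule.mk_cancel_common_left]
    rw [h, h]
    abel)

theorem theta_smul (S : ℂ⟦X⟧) (z : Loc E) :
    theta E (S • z) = S • theta E z + (X * derivative ℂ S) • z := by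
  induction z using LocalizedModule.induction_on with | h x s => ?_
  rw [LocalizedModule.smul'_mk]
  change thetaAux _ = S • thetaAux _ + _
  simp only [thetaAux, smul_sub, LocalizedModule.smul'_mk, a_smul]
  have e1 : LocalizedModule.mk (S • a x + (X ^ 2 * derivative ℂ S) • x) (bDen * s) =
      LocalizedModule.mk (S • a x) (bDen * s)
        + LocalizedModule.mk ((X * derivative ℂ S) • x) s := by
    rw [LocalizedModule.mk_add_mk, LocalizedModule.mk_eq]
    refine ⟨1, ?_⟩
    simp only [Submonoid.smul_def, smul_add, smul_smul, Submonoid.coe_mul,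
      Submonoid.coe_one, bDen]
    congr 2 <;> ring
  rw [e1, smul_comm S]
  abel

/-- The saturation `E♯` of `E` by `b⁻¹ a`: the smallest `ℂ[[b]]`-submodule of `E[b⁻¹]` that contains
`E` and is stable by `b⁻¹ a`. -/
def saturation : Submodule ℂ⟦X⟧ (Loc E) :=
  sInf {M | (∀ x : E, LocalizedModule.mk x 1 ∈ M) ∧ ∀ z ∈ M, theta E z ∈ M}

theorem theta_mem_saturation (z : Loc E) (hz : z ∈ saturation E) : theta E z ∈ saturation E := by
  rw [saturation, Submodule.mem_sInf] at hz ⊢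
  exact fun M hM => hM.2 z (hz M hM)

/-- `b⁻¹ a` as an operator on `E♯`. -/
def thetaSat : saturation E →+ saturation E :=
  AddMonoidHom.mk' (fun z => ⟨theta E z.1, theta_mem_saturation E z.1 z.2⟩)
    (fun z w => by ext; simp)

theorem thetaSat_smul (S : ℂ⟦X⟧) (z : saturation E) :
    thetaSat E (S • z) = S • thetaSat E z + (X * derivative ℂ S) • z :=
  Subtype.ext (theta_smul E S z.1)

/-- The complex vector space `E♯ / b E♯`. -/
abbrev SatQuot : Type u :=
  saturation E ⧸ ((X : ℂ⟦X⟧) • (⊤ : Submodule ℂ⟦X⟧ (saturation E)))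

instance : Module ℂ (SatQuot E) := Module.compHom (SatQuot E) (C : ℂ →+* ℂ⟦X⟧)

theorem thetaSat_mem (z : saturation E)
    (hz : z ∈ (X : ℂ⟦X⟧) • (⊤ : Submodule ℂ⟦X⟧ (saturation E))) :
    thetaSat E z ∈ (X : ℂ⟦X⟧) • (⊤ : Submodule ℂ⟦X⟧ (saturation E)) := by
  obtain ⟨w, -, rfl⟩ := (Submodule.mem_smul_pointwise_iff_exists _ _ _).1 hz
  rw [thetaSat_smul, mul_smul, ← smul_add]
  exact Submodule.smul_mem_pointwise_smul _ _ _ trivial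

/-- The endomorphism of `E♯ / b E♯` induced by `b⁻¹ a`. -/
def thetaBar : Module.End ℂ (SatQuot E) where
  toFun := QuotientAddGroup.map
    ((X : ℂ⟦X⟧) • (⊤ : Submodule ℂ⟦X⟧ (saturation E))).toAddSubgroup
    ((X : ℂ⟦X⟧) • (⊤ : Submodule ℂ⟦X⟧ (saturation E))).toAddSubgroup
    (thetaSat E) (thetaSat_mem E)
  map_add' := map_add _
  map_smul' c z := by
    obtain ⟨z, rfl⟩ := Submodule.Quotient.mk_surjective _ z
    have h := thetaSat_smul E (C c) z
    rw [show derivative ℂ (C c) = 0 from (derivative ℂ).map_algebraMap c, mul_zero, zero_smul,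
      add_zero] at h
    exact congrArg (Submodule.Quotient.mk
      (p := (X : ℂ⟦X⟧) • (⊤ : Submodule ℂ⟦X⟧ (saturation E)))) h

/-- The Bernstein polynomial of a regular `E`: the minimal polynomial of `-b⁻¹ a` on
`E♯ / b E♯`. -/
def bernsteinPolynomial : Polynomial ℂ := minpoly ℂ (-thetaBar E)

/-- A regular `E` is `[l]`-primitive when all roots of its Bernstein polynomial are in `-l + ℤ`. -/
def IsPrimitive (l : ℚ) : Prop :=
  ∀ r : ℂ, (bernsteinPolynomial E).IsRoot r → ∃ n : ℤ, r = -(l : ℂ) + n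

end Bernstein

/-! ### Jordan–Hölder sequences -/

/-- `E_z = Ã / Ã (a - z b)`, which is the module `ℂ[[b]] e` with `a e = z b e`. -/
def RankOne (_ : ℂ) : Type := ℂ⟦X⟧

instance (z : ℂ) : AddCommGroup (RankOne z) := inferInstanceAs (AddCommGroup ℂ⟦X⟧)

instance (z : ℂ) : Module ℂ⟦X⟧ (RankOne z) := inferInstanceAs (Module ℂ⟦X⟧ ℂ⟦X⟧)

/-- `a (S e) = (b² S' + z b S) e`. -/
def RankOne.aFun (z : ℂ) (S : ℂ⟦X⟧) : ℂ⟦X⟧ := X ^ 2 * derivative ℂ S + C z * (X * S)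

theorem RankOne.aFun_add (z : ℂ) (S T : ℂ⟦X⟧) :
    RankOne.aFun z (S + T) = RankOne.aFun z S + RankOne.aFun z T := by
  simp only [RankOne.aFun, map_add]
  ring

theorem RankOne.aFun_mul (z : ℂ) (S T : ℂ⟦X⟧) :
    RankOne.aFun z (S * T) = S * RankOne.aFun z T + X ^ 2 * derivative ℂ S * T := by
  simp only [RankOne.aFun, Derivation.leibniz, smul_eq_mul]
  ring

instance (z : ℂ) : ABStructure (RankOne z) where
  a := AddMonoidHom.mk' (RankOne.aFun z) (RankOne.aFun_add z)
  a_smul := RankOne.aFun_mul z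

section JordanHolder

variable {E : Type u} [AddCommGroup E] [Module ℂ⟦X⟧ E] [ABStructure E]

/-- A Jordan–Hölder sequence `0 = F_0 ⊆ F_1 ⊆ ⋯ ⊆ F_k = E`: normal submodules whose successive
quotients have rank one over `ℂ[[b]]`. -/
structure IsJordanHolder {k : ℕ} (F : Fin (k + 1) → Sub E) : Prop where
  zero : (F 0).carrier = ⊥
  last : (F (Fin.last k)).carrier = ⊤
  le : ∀ j : Fin k, (F j.castSucc).carrier ≤ (F j.succ).carrier
  normal : ∀ j, (F j).IsNormal
  rank_one : ∀ j : Fin k, Module.finrank ℂ⟦X⟧ (Subquotient (F j.succ) (F j.castSucc)) = 1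

/-- `F_j / F_(j-1) ≃ E_(μ_j)` for `j = 1, …, k`; the index `j : Fin k` stands for `j + 1`. -/
def HasInvariants {k : ℕ} (F : Fin (k + 1) → Sub E) (μ : Fin k → ℂ) : Prop :=
  ∀ j : Fin k, Nonempty (Iso (Subquotient (F j.succ) (F j.castSucc)) (RankOne (μ j)))

/-- A Jordan–Hölder sequence is principal when `F_j / F_(j-1) ≃ E_(μ_j)` with `μ_j` real and
`j ↦ μ_j + j` non-decreasing. -/
def IsPrincipal {k : ℕ} (F : Fin (k + 1) → Sub E) : Prop :=
  IsJordanHolder F ∧ ∃ μ : Fin k → ℝ, HasInvariants F (fun j => (μ j : ℂ)) ∧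
    Monotone (fun j : Fin k => μ j + ((j : ℕ) + 1 : ℝ))

end JordanHolder

end ABStructure

end

/-! Rank one quotients `E_z` of a submodule `G` are studied through surjective functionals `π : G →
ℂ[[b]]` with `IsHom z π`. Three facts carry the proof.

Cyclicity: `a` and `b` act on each `E_z` with values in `b E_z`, so the constant term of `π x`
factors through `G / (aG + bG)`, which a generator spans. Hence a cyclic module has no quotient `E_z
⊕ E_w` (`IsGen.constantCoeff_eq_zero`), and the kernel of `G → E_z` is again cyclic, generated by
`(a - z b) e` when `π e = 1` (`IsGen.ker`).

Uniqueness: in a principal sequence, the last exponent is the largest `z` for which `E_z` is a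
quotient, and only one kernel realises it (`IsChain.le_last`). A morphism not killing `F_(k-1)`
restricts there to `b^p` times a surjection onto `E_(z+p)`; cyclicity gives `p ≥ 1`, and the allowed
drop of one between successive exponents is absorbed by `p`. Induction on the rank then determines
the whole sequence.

Existence: take a quotient `E_z` with `z` maximal and apply induction to its kernel. If the next
exponent `w` exceeded `z + 1`, the integer gap would allow an exchange producing a quotient
`E_(w-1)` with `w - 1 > z` (`IsHom.exchange`), contradicting maximality.

Primitivity reduces `E` to expansions with the single exponent `l` (`IsFresco.embeds`). There
nonzero submodules have rank one quotients, all their exponents lie in `l + ℕ`, and these exponents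
are bounded on each submodule. -/

namespace ABStructure

/-! ### Morphisms to `E_z`, cyclic modules, and the exchange construction. -/

section Hom

theorem X_mul_derivative_X_pow (n : ℕ) :
    X * derivative ℂ (X ^ n : ℂ⟦X⟧) = (n : ℂ⟦X⟧) * X ^ n := by
  rcases n with _ | n
  · simp
  · simp only [Derivation.leibniz_pow, derivative_X]
    simp [pow_succ]
    ring

/-- Multiplication by `b^n` is a morphism `E_(z+n) → E_z`. This is why dividing a morphism by `b^p`
raises its exponent by `p`. -/
theorem RankOne.aFun_X_pow_mul (z : ℂ) (n : ℕ) (S : ℂ⟦X⟧) :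
    RankOne.aFun z (X ^ n * S) = X ^ n * RankOne.aFun (z + n) S := by
  have h := X_mul_derivative_X_pow n
  simp only [RankOne.aFun, Derivation.leibniz, smul_eq_mul, map_add, map_natCast]
  linear_combination X * S * h

theorem RankOne.coeff_succ_aFun (z : ℂ) (n : ℕ) (S : ℂ⟦X⟧) :
    coeff (n + 1) (RankOne.aFun z S) = (n + z) * coeff n S := by
  rw [RankOne.aFun, map_add, coeff_C_mul, coeff_succ_X_mul, pow_two, mul_assoc, coeff_succ_X_mul]
  rcases n with _ | n
  · simp
  · rw [coeff_succ_X_mul, coeff_derivative]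
    push_cast
    ring

theorem RankOne.constantCoeff_aFun (z : ℂ) (S : ℂ⟦X⟧) :
    constantCoeff (RankOne.aFun z S) = 0 := by
  simp [RankOne.aFun]

/-- A solution of `a t = z b t` in `E_w`, if non-zero, forces `z ∈ w + ℕ`. -/
theorem RankOne.exists_eq_add_nat {z w : ℂ} {t : ℂ⟦X⟧} (ht : t ≠ 0)
    (h : RankOne.aFun w t = C z * (X * t)) :
    ∃ n : ℕ, z = w + n ∧ X ^ n ∣ t := by
  -- At most one `n` satisfies `n + w = z`, so a nonzero `t` is a monomial.
  have key : ∀ n, (n + w - z) * coeff n t = 0 := fun n => by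
    have := congrArg (coeff (n + 1)) h
    rw [RankOne.coeff_succ_aFun, coeff_C_mul, coeff_succ_X_mul] at this
    linear_combination this
  obtain ⟨n, hn⟩ : ∃ n, coeff n t ≠ 0 := by
    by_contra! hc
    exact ht (PowerSeries.ext (by simpa using hc))
  have hz : z = w + n := by
    have := (mul_eq_zero.1 (key n)).resolve_right hn
    linear_combination -this
  refine ⟨n, hz, X_pow_dvd_iff.2 fun m hm => ?_⟩
  refine (mul_eq_zero.1 (key m)).resolve_left fun h0 => hm.ne ?_
  have : (m : ℂ) = n := by rw [hz] at h0; linear_combination h0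
  exact_mod_cast this

section Linear

variable {E : Type u} [AddCommGroup E] [Module ℂ⟦X⟧ E]

theorem surjective_of_constantCoeff_ne_zero {π : E →ₗ[ℂ⟦X⟧] ℂ⟦X⟧} {x : E}
    (hx : constantCoeff (π x) ≠ 0) : Function.Surjective π := by
  obtain ⟨u, hu⟩ := isUnit_iff_constantCoeff.2 (isUnit_iff_ne_zero.2 hx)
  intro S
  refine ⟨(S * ↑u⁻¹) • x, ?_⟩
  rw [map_smul, smul_eq_mul, ← hu, mul_assoc, Units.inv_mul, mul_one]

theorem exists_eq_X_pow_mul_of_dvd {π : E →ₗ[ℂ⟦X⟧] ℂ⟦X⟧} {p : ℕ} (h : ∀ x, X ^ p ∣ π x) :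
    ∃ π' : E →ₗ[ℂ⟦X⟧] ℂ⟦X⟧, ∀ x, π x = X ^ p * π' x := by
  choose f hf using h
  have h0 : (X ^ p : ℂ⟦X⟧) ≠ 0 := pow_ne_zero _ X_ne_zero
  refine ⟨⟨⟨f, fun x y => mul_left_cancel₀ h0 ?_⟩, fun S x => mul_left_cancel₀ h0 ?_⟩, hf⟩
  · rw [← hf, map_add, hf, hf, mul_add]
  · rw [← hf, map_smul, hf, smul_eq_mul, RingHom.id_apply, smul_eq_mul]
    ring

theorem exists_eq_X_pow_mul {π : E →ₗ[ℂ⟦X⟧] ℂ⟦X⟧} (h : π ≠ 0) :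
    ∃ (p : ℕ) (π' : E →ₗ[ℂ⟦X⟧] ℂ⟦X⟧), Function.Surjective π' ∧ ∀ x, π x = X ^ p * π' x := by
  classical
  have hex : ∃ n, ∃ x, coeff n (π x) ≠ 0 := by
    by_contra! hc
    exact h (LinearMap.ext fun x => PowerSeries.ext (by simpa using fun n => hc n x))
  obtain ⟨π', hπ'⟩ := exists_eq_X_pow_mul_of_dvd (π := π) (p := Nat.find hex) fun x =>
    X_pow_dvd_iff.2 fun m hm => by
      have := Nat.find_min hex hm
      push Not at this
      exact this x
  obtain ⟨x, hx⟩ := Nat.find_spec hex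
  refine ⟨_, π', surjective_of_constantCoeff_ne_zero (x := x) ?_, hπ'⟩
  rwa [hπ', coeff_X_pow_mul', if_pos le_rfl, Nat.sub_self, coeff_zero_eq_constantCoeff_apply] at hx

end Linear

variable {E : Type u} [AddCommGroup E] [Module ℂ⟦X⟧ E] [ABStructure E]

/-- `π` is a morphism of `Ã`-modules from `E` to `E_z`. -/
def IsHom (z : ℂ) (π : E →ₗ[ℂ⟦X⟧] ℂ⟦X⟧) : Prop :=
  ∀ x, π (a x) = RankOne.aFun z (π x)

theorem IsHom.of_X_pow_mul {z : ℂ} {π π' : E →ₗ[ℂ⟦X⟧] ℂ⟦X⟧} (hπ : IsHom z π) {p : ℕ}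
    (h : ∀ x, π x = X ^ p * π' x) : IsHom (z + p) π' := fun x =>
  mul_left_cancel₀ (pow_ne_zero p X_ne_zero)
    (by rw [← h, hπ, h, RankOne.aFun_X_pow_mul])

theorem IsHom.constantCoeff_a {z : ℂ} {π : E →ₗ[ℂ⟦X⟧] ℂ⟦X⟧} (hπ : IsHom z π) (x : E) :
    constantCoeff (π (a x)) = 0 := by
  rw [hπ, RankOne.constantCoeff_aFun]

/-- The image of `π` is a nonzero ideal `b^p ℂ[[b]]`, which is a copy of `E_(z+p)` inside `E_z`. -/
theorem IsHom.exists_surjective {z : ℂ} {π : E →ₗ[ℂ⟦X⟧] ℂ⟦X⟧} (hπ : IsHom z π) (h : π ≠ 0) :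
    ∃ (p : ℕ) (π' : E →ₗ[ℂ⟦X⟧] ℂ⟦X⟧), IsHom (z + p) π' ∧ Function.Surjective π' ∧
      ∀ x, π x = X ^ p * π' x := by
  obtain ⟨p, π', h1, h2⟩ := exists_eq_X_pow_mul h
  exact ⟨p, π', hπ.of_X_pow_mul h2, h1, h2⟩

/-- A morphism to `E_w` that vanishes on the kernel of a surjective morphism to `E_z`. -/
theorem IsHom.factor {z w : ℂ} {π ρ : E →ₗ[ℂ⟦X⟧] ℂ⟦X⟧} (hπ : IsHom z π)
    (hs : Function.Surjective π) (hρ : IsHom w ρ) (h : ∀ x, π x = 0 → ρ x = 0) (h0 : ρ ≠ 0) :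
    ∃ n : ℕ, z = w + n ∧ (Function.Surjective ρ → n = 0) ∧ ∀ x, ρ x = 0 → π x = 0 := by
  obtain ⟨e, he⟩ := hs 1
  -- Since `x - π x • e` is killed by `π`, hence by `ρ`, the map `ρ` is `π` followed by
  -- multiplication by `ρ e`. This `ρ e` solves `a t = z b t` in `E_w`.
  have hρe : ∀ x, ρ x = π x * ρ e := fun x => by
    have := h (x - π x • e) (by simp [he])
    rwa [map_sub, map_smul, smul_eq_mul, sub_eq_zero] at this
  have ht : ρ e ≠ 0 := fun h' => h0 (LinearMap.ext fun x => by rw [hρe, h', mul_zero]; rfl)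
  obtain ⟨n, hn, hd⟩ := RankOne.exists_eq_add_nat (z := z) (w := w) ht (by
    rw [← hρ, hρe, hπ, he, RankOne.aFun, ← map_one (C : ℂ →+* ℂ⟦X⟧), derivative_C]
    simp [mul_assoc])
  refine ⟨n, hn, fun hsρ => ?_, fun x hx => ?_⟩
  · obtain ⟨y, hy⟩ := hsρ 1
    by_contra hn0
    have : (X : ℂ⟦X⟧) ∣ 1 := by
      rw [← hy, hρe]
      exact ((dvd_pow_self _ hn0).trans hd).mul_left _
    simp [X_dvd_iff] at this
  · rw [hρe] at hx
    exact (mul_eq_zero.1 hx).resolve_right ht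

/-- `E = Ã e`. -/
def IsGen (e : E) : Prop :=
  ∀ M : Submodule ℂ⟦X⟧ E, e ∈ M → (∀ x ∈ M, a x ∈ M) → M = ⊤

/-- The factor `c` is the class of `x` in `E / (aE + bE)`, spanned by the class of `e`. The point is
that it serves all `z` and `π` at once, so that two different quotients can be compared. -/
theorem IsGen.constantCoeff {e : E} (he : IsGen e) (x : E) :
    ∃ c : ℂ, ∀ (z : ℂ) (π : E →ₗ[ℂ⟦X⟧] ℂ⟦X⟧), IsHom z π →
      constantCoeff (π x) = c * constantCoeff (π e) := by
  let M : Submodule ℂ⟦X⟧ E :=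
    { carrier := {x | ∃ c : ℂ, ∀ (z : ℂ) (π : E →ₗ[ℂ⟦X⟧] ℂ⟦X⟧), IsHom z π →
        PowerSeries.constantCoeff (π x) = c * PowerSeries.constantCoeff (π e)}
      zero_mem' := ⟨0, fun z π _ => by simp⟩
      add_mem' := by
        rintro x y ⟨c, hc⟩ ⟨d, hd⟩
        exact ⟨c + d, fun z π h => by rw [map_add, map_add, hc z π h, hd z π h, add_mul]⟩
      smul_mem' := by
        rintro S x ⟨c, hc⟩
        exact ⟨PowerSeries.constantCoeff S * c, fun z π h => by
          rw [map_smul, smul_eq_mul, map_mul, hc z π h, mul_assoc]⟩ }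
  have hM : M = ⊤ := he M ⟨1, fun z π _ => by simp⟩
    fun x _ => ⟨0, fun z π h => by rw [h.constantCoeff_a, zero_mul]⟩
  exact (hM ▸ Submodule.mem_top : x ∈ M)

theorem IsGen.constantCoeff_ne_zero {e : E} (he : IsGen e) {z : ℂ} {π : E →ₗ[ℂ⟦X⟧] ℂ⟦X⟧}
    (hπ : IsHom z π) (hs : Function.Surjective π) : PowerSeries.constantCoeff (π e) ≠ 0 := by
  intro h
  obtain ⟨x, hx⟩ := hs 1
  obtain ⟨c, hc⟩ := he.constantCoeff x
  have := hc z π hπ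
  rw [hx, h] at this
  simp at this

/-- A cyclic module has no quotient `E_z ⊕ E_w`. -/
theorem IsGen.constantCoeff_eq_zero {e : E} (he : IsGen e) {z w : ℂ}
    {π ρ : E →ₗ[ℂ⟦X⟧] ℂ⟦X⟧} (hπ : IsHom z π) (hs : Function.Surjective π) (hρ : IsHom w ρ)
    {x : E} (hx : π x = 0) : PowerSeries.constantCoeff (ρ x) = 0 := by
  obtain ⟨c, hc⟩ := he.constantCoeff x
  have h := hc z π hπ
  rw [hx, map_zero, eq_comm, mul_eq_zero, or_iff_left (he.constantCoeff_ne_zero hπ hs)] at h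
  rw [hc w ρ hρ, h, zero_mul]

/-- A generator can be normalised with respect to a surjective morphism. -/
theorem IsGen.exists_map_eq_one {e : E} (he : IsGen e) {z : ℂ} {π : E →ₗ[ℂ⟦X⟧] ℂ⟦X⟧}
    (hπ : IsHom z π) (hs : Function.Surjective π) : ∃ e' : E, IsGen e' ∧ π e' = 1 := by
  obtain ⟨u, hu⟩ := isUnit_iff_constantCoeff.2
    (isUnit_iff_ne_zero.2 (he.constantCoeff_ne_zero hπ hs))
  refine ⟨(↑u⁻¹ : ℂ⟦X⟧) • e, fun M hM ha => he M ?_ ha, ?_⟩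
  · have := M.smul_mem (u : ℂ⟦X⟧) hM
    rwa [smul_smul, Units.mul_inv, one_smul] at this
  · rw [map_smul, ← hu, smul_eq_mul, Units.inv_mul]

/-- The kernel of a surjective morphism from a cyclic module to `E_z` is cyclic. -/
theorem IsGen.le_of_ker {e : E} (he : IsGen e) {z : ℂ} {π : E →ₗ[ℂ⟦X⟧] ℂ⟦X⟧}
    (h1 : π e = 1) {M : Submodule ℂ⟦X⟧ E} (hM : M ≤ LinearMap.ker π)
    (hf : a e - (C z * X) • e ∈ M) (ha : ∀ x ∈ M, a x ∈ M) : M = LinearMap.ker π := by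
  -- Modulo `M`, `a e` equals `z b e`, so this sum is stable by `a`. On it `π` reads off the
  -- coefficient of `e`, so its elements killed by `π` lie in `M`.
  have htop : M ⊔ Submodule.span ℂ⟦X⟧ {e} = ⊤ := by
    refine he _ (Submodule.mem_sup_right (Submodule.mem_span_singleton_self e)) fun x hx => ?_
    obtain ⟨m, hm, y, hy, rfl⟩ := Submodule.mem_sup.1 hx
    obtain ⟨S, rfl⟩ := Submodule.mem_span_singleton.1 hy
    refine Submodule.mem_sup.2 ⟨a m + S • (a e - (C z * X) • e),
      M.add_mem (ha m hm) (M.smul_mem S hf),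
      (S * (C z * X) + X ^ 2 * derivative ℂ S) • e, Submodule.mem_span_singleton.2 ⟨_, rfl⟩, ?_⟩
    rw [map_add, a_smul, smul_sub, smul_smul, add_smul]
    abel
  refine le_antisymm hM fun x hx => ?_
  obtain ⟨m, hm, y, hy, rfl⟩ := Submodule.mem_sup.1 (htop ▸ Submodule.mem_top : x ∈ _)
  obtain ⟨S, rfl⟩ := Submodule.mem_span_singleton.1 hy
  have h0 : π (m + S • e) = 0 := hx
  rw [map_add, map_smul, h1, LinearMap.mem_ker.1 (hM hm), zero_add, smul_eq_mul, mul_one] at h0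
  rwa [h0, zero_smul, add_zero]

/-- The exchange of two successive quotients `E_w`, `E_z` of a cyclic module when `w - 1 - z` is
a positive integer: a new quotient `E_(w-1)`. -/
theorem IsHom.exchange {e : E} {z : ℂ} {π : E →ₗ[ℂ⟦X⟧] ℂ⟦X⟧} (hπ : IsHom z π)
    (h1 : π e = 1) (K : Sub E) (hK : K.carrier = LinearMap.ker π) {n : ℕ}
    {ρ : K.carrier →ₗ[ℂ⟦X⟧] ℂ⟦X⟧} (hρ : IsHom (z + (n + 1) + 1) ρ)
    {f : K.carrier} (hfe : f.1 = a e - (C z * X) • e)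
    (hS : PowerSeries.constantCoeff (ρ f) ≠ 0) :
    ∃ ψ : E →ₗ[ℂ⟦X⟧] ℂ⟦X⟧, IsHom (z + (n + 1)) ψ ∧ Function.Surjective ψ := by
  -- On the kernel, `X * ρ` is a morphism to `E_(w-1)`; it is extended to `E` by the value `U` at
  -- `e`. Compatibility with `a` at `e` amounts to `b U' + (n + 1) U = ρ f`, solvable
  -- coefficientwise as `m + n + 1 ≠ 0`. The constant term of `U` is nonzero, whence surjectivity.
  let U : ℂ⟦X⟧ := PowerSeries.mk fun m => coeff m (ρ f) / (m + (n + 1) : ℂ)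
  have hU : X * derivative ℂ U + C (n + 1 : ℂ) * U = ρ f := by
    ext m
    have hne : (m + (n + 1) : ℂ) ≠ 0 := by exact_mod_cast (by omega : m + (n + 1) ≠ 0)
    rw [map_add, coeff_C_mul]
    have : coeff m (X * derivative ℂ U) = m * coeff m U := by
      rcases m with _ | m
      · simp
      · rw [coeff_succ_X_mul, coeff_derivative]
        push_cast
        ring
    rw [this, coeff_mk]
    field_simp
  have hmem : ∀ x, x - π x • e ∈ K.carrier := fun x => by
    rw [hK, LinearMap.mem_ker, map_sub, map_smul, h1, smul_eq_mul, mul_one, sub_self]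
  let P : E →ₗ[ℂ⟦X⟧] K.carrier :=
    { toFun := fun x => ⟨x - π x • e, hmem x⟩
      map_add' := fun x y => by
        ext
        simp only [map_add, add_smul, Submodule.coe_add]
        abel
      map_smul' := fun S x => by
        ext
        simp [smul_sub, smul_smul] }
  let ψ : E →ₗ[ℂ⟦X⟧] ℂ⟦X⟧ :=
    (LinearMap.mulLeft ℂ⟦X⟧ (X : ℂ⟦X⟧)).comp (ρ.comp P) +
      (LinearMap.mulRight ℂ⟦X⟧ U).comp π
  have hψ : ∀ x, ψ x = X * ρ (P x) + π x * U := fun x => rfl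
  refine ⟨ψ, fun x => ?_, surjective_of_constantCoeff_ne_zero (x := e) ?_⟩
  · have hP : P (a x) = a (P x) + π x • f := by
      ext
      change a x - π (a x) • e = a (x - π x • e) + π x • f.1
      rw [map_sub, a_smul, hπ, RankOne.aFun, hfe, smul_sub, smul_smul, add_smul,
        show C z * (X * π x) = π x * (C z * X) by ring]
      abel
    rw [hψ, hψ, hP, map_add, hρ, map_smul, smul_eq_mul, hπ]
    simp only [RankOne.aFun, map_add, map_one, Derivation.leibniz, smul_eq_mul, derivative_X] at hU ⊢
    linear_combination (-X * π x) * hU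
  · rw [hψ, show P e = 0 by ext; simp [P, h1], h1, map_zero, mul_zero, zero_add, one_mul,
      ← coeff_zero_eq_constantCoeff_apply, coeff_mk]
    have hne : (n + 1 : ℂ) ≠ 0 := by exact_mod_cast n.succ_ne_zero
    simpa using ⟨hS, hne⟩

end Hom

/-! ### Filtrations with rank one quotients and uniqueness of the principal one. -/

section Chain

variable {E : Type u} [AddCommGroup E] [Module ℂ⟦X⟧ E] [ABStructure E]

/-- `F ⊆ G` and `G / F ≃ E_z`, expressed by a surjective morphism from `G` with kernel `F`. -/
def Step (F G : Sub E) (z : ℂ) : Prop :=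
  F.carrier ≤ G.carrier ∧ ∃ π : G.carrier →ₗ[ℂ⟦X⟧] ℂ⟦X⟧, IsHom z π ∧ Function.Surjective π ∧
    ∀ x, π x = 0 ↔ x.1 ∈ F.carrier

theorem step_iff {F G : Sub E} (h : F.carrier ≤ G.carrier) {z : ℂ} :
    Step F G z ↔ Nonempty (Iso (Subquotient G F) (RankOne z)) := by
  constructor
  · rintro ⟨-, π, hπ, hs, hk⟩
    have hker : (F.restrict G).carrier = LinearMap.ker π := by
      ext x
      exact (hk x).symm
    let ψ : Subquotient G F ≃ₗ[ℂ⟦X⟧] ℂ⟦X⟧ :=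
      (Submodule.quotEquivOfEq _ _ hker).trans (π.quotKerEquivOfSurjective hs)
    refine ⟨⟨(ψ : Subquotient G F ≃ₗ[ℂ⟦X⟧] RankOne z), fun x => ?_⟩⟩
    obtain ⟨x, rfl⟩ := Submodule.Quotient.mk_surjective _ x
    exact hπ x
  · rintro ⟨φ⟩
    let π : G.carrier →ₗ[ℂ⟦X⟧] RankOne z :=
      (φ.toLinearEquiv : Subquotient G F →ₗ[ℂ⟦X⟧] RankOne z).comp
        (F.restrict G).carrier.mkQ
    refine ⟨h, (π : G.carrier →ₗ[ℂ⟦X⟧] ℂ⟦X⟧), fun x => ?_, ?_, fun x => ?_⟩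
    · exact φ.map_a (Submodule.Quotient.mk x)
    · exact φ.toLinearEquiv.surjective.comp (Submodule.mkQ_surjective _)
    · change φ.toLinearEquiv (Submodule.Quotient.mk x) = 0 ↔ _
      rw [LinearEquiv.map_eq_zero_iff, Submodule.Quotient.mk_eq_zero]
      rfl

theorem Step.unique {F G : Sub E} {z w : ℂ} (h : Step F G z) (h' : Step F G w) : z = w := by
  obtain ⟨-, π, hπ, hs, hk⟩ := h
  obtain ⟨-, ρ, hρ, hs', hk'⟩ := h'
  have h0 : ρ ≠ 0 := by
    rintro rfl
    obtain ⟨x, hx⟩ := hs' 1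
    simp at hx
  obtain ⟨n, hn, hn0, -⟩ := hπ.factor hs hρ (fun x hx => (hk' x).2 ((hk x).1 hx)) h0
  rw [hn, hn0 hs', Nat.cast_zero, add_zero]

/-- The kernel of a morphism from `G` to `E_z`. -/
noncomputable def kerSub (G : Sub E) {z : ℂ} {π : G.carrier →ₗ[ℂ⟦X⟧] ℂ⟦X⟧} (hπ : IsHom z π) : Sub E where
  carrier := (LinearMap.ker π).map G.carrier.subtype
  a_mem := by
    rintro _ ⟨x, hx, rfl⟩
    refine ⟨a x, ?_, rfl⟩
    have hx' : π x = 0 := hx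
    change π (a x) = 0
    rw [hπ, hx', RankOne.aFun]
    simp

theorem mem_kerSub {G : Sub E} {z : ℂ} {π : G.carrier →ₗ[ℂ⟦X⟧] ℂ⟦X⟧} (hπ : IsHom z π)
    (x : G.carrier) : x.1 ∈ (kerSub G hπ).carrier ↔ π x = 0 := by
  constructor
  · rintro ⟨y, hy, hyx⟩
    rw [← show y = x from Subtype.ext hyx]
    exact hy
  · exact fun h => ⟨x, h, rfl⟩

theorem kerSub_le {G : Sub E} {z : ℂ} {π : G.carrier →ₗ[ℂ⟦X⟧] ℂ⟦X⟧} (hπ : IsHom z π) :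
    (kerSub G hπ).carrier ≤ G.carrier := by
  rintro _ ⟨y, -, rfl⟩
  exact y.2

theorem step_kerSub {G : Sub E} {z : ℂ} {π : G.carrier →ₗ[ℂ⟦X⟧] ℂ⟦X⟧} (hπ : IsHom z π)
    (hs : Function.Surjective π) : Step (kerSub G hπ) G z :=
  ⟨kerSub_le hπ, π, hπ, hs, fun x => (mem_kerSub hπ x).symm⟩

/-- Restriction of a morphism to a submodule. -/
theorem IsHom.comp_inclusion {F G : Sub E} (h : F.carrier ≤ G.carrier) {z : ℂ}
    {π : G.carrier →ₗ[ℂ⟦X⟧] ℂ⟦X⟧} (hπ : IsHom z π) :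
    IsHom z (π.comp (Submodule.inclusion h)) :=
  fun x => hπ (Submodule.inclusion h x)

/-- Cyclicity descends along a filtration. The explicit generator `(a - z b) e` is also what the
exchange needs. -/
theorem IsGen.ker {F G : Sub E} (h : F.carrier ≤ G.carrier) {z : ℂ}
    {π : G.carrier →ₗ[ℂ⟦X⟧] ℂ⟦X⟧} (hπ : IsHom z π) (hk : ∀ x, π x = 0 ↔ x.1 ∈ F.carrier)
    {e : G.carrier} (he : IsGen e) (h1 : π e = 1) :
    ∃ f : F.carrier, Submodule.inclusion h f = a e - (C z * X) • e ∧ IsGen f := by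
  have hf : π (a e - (C z * X) • e) = 0 := by
    rw [map_sub, map_smul, hπ, h1, RankOne.aFun, ← map_one (C : ℂ →+* ℂ⟦X⟧), derivative_C]
    simp
  refine ⟨⟨(a e - (C z * X) • e).1, (hk _).1 hf⟩, rfl, fun M hM ha => ?_⟩
  have key := he.le_of_ker (M := M.map (Submodule.inclusion h)) h1 ?_ ⟨_, hM, rfl⟩ ?_
  · refine eq_top_iff.2 fun x _ => ?_
    have hx : Submodule.inclusion h x ∈ LinearMap.ker π := (hk _).2 x.2
    rw [← key] at hx
    obtain ⟨y, hy, hyx⟩ := hx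
    rwa [← Submodule.inclusion_injective h hyx]
  · rintro _ ⟨y, -, rfl⟩
    exact (hk _).2 y.2
  · rintro _ ⟨y, hy, rfl⟩
    exact ⟨a y, ha y hy, rfl⟩

theorem Step.exists_isGen {F G : Sub E} {z : ℂ} (h : Step F G z) (hG : ∃ e : G.carrier, IsGen e) :
    ∃ f : F.carrier, IsGen f := by
  obtain ⟨hle, π, hπ, hs, hk⟩ := h
  obtain ⟨e, he⟩ := hG
  obtain ⟨e, he, h1⟩ := he.exists_map_eq_one hπ hs
  obtain ⟨f, -, hf⟩ := he.ker hle hπ hk h1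
  exact ⟨f, hf⟩

/-- A filtration with quotients `E_(μ_j)`, `μ_j` real and `j ↦ μ_j + j` non-decreasing. -/
structure IsChain {k : ℕ} (F : Fin (k + 1) → Sub E) (μ : Fin k → ℝ) : Prop where
  zero : (F 0).carrier = ⊥
  step : ∀ j : Fin k, Step (F j.castSucc) (F j.succ) (μ j : ℂ)
  mono : Monotone (fun j : Fin k => μ j + ((j : ℕ) + 1 : ℝ))

theorem IsChain.init {k : ℕ} {F : Fin (k + 2) → Sub E} {μ : Fin (k + 1) → ℝ}
    (h : IsChain F μ) : IsChain (fun j => F j.castSucc) (fun j => μ j.castSucc) where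
  zero := h.zero
  step j := h.step j.castSucc
  mono _ _ hij := h.mono (Fin.castSucc_le_castSucc_iff.2 hij)

/-- Maximality of the last quotient of a principal filtration of a cyclic module. -/
theorem IsChain.le_last {k : ℕ} : ∀ {F : Fin (k + 2) → Sub E} {μ : Fin (k + 1) → ℝ},
    IsChain F μ → (∃ e : (F (Fin.last k).succ).carrier, IsGen e) → ∀ {z : ℂ}
    {π : (F (Fin.last k).succ).carrier →ₗ[ℂ⟦X⟧] ℂ⟦X⟧}, IsHom z π → Function.Surjective π →
    ∃ r : ℝ, z = r ∧ r ≤ μ (Fin.last k) ∧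
      (r = μ (Fin.last k) → ∀ x, π x = 0 ↔ x.1 ∈ (F (Fin.last k).castSucc).carrier) := by
  induction k with
  | zero =>
    intro F μ h hG z π hπ hs
    obtain ⟨hle, ρ, hρ, hρs, hk⟩ := h.step (Fin.last 0)
    have hbot : (F (Fin.last 0).castSucc).carrier = ⊥ := h.zero
    have hF : ∀ x, ρ x = 0 → x = 0 := fun x hx => by
      have := (hk x).1 hx
      rw [hbot] at this
      exact Subtype.ext ((Submodule.mem_bot _).1 this)
    have h0 : π ≠ 0 := by
      rintro rfl
      obtain ⟨x, hx⟩ := hs 1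
      simp at hx
    obtain ⟨n, hn, hn0, hker⟩ := hρ.factor hρs hπ (fun x hx => by rw [hF x hx, map_zero]) h0
    rw [hn0 hs, Nat.cast_zero, add_zero] at hn
    exact ⟨μ (Fin.last 0), hn.symm, le_rfl, fun _ x => ⟨fun hx => (hk x).1 (hker x hx),
      fun hx => by rw [hF x ((hk x).2 hx), map_zero]⟩⟩
  | succ k ih =>
    intro F μ h hG z π hπ hs
    have hst := h.step (Fin.last (k + 1))
    have hK := hst.exists_isGen hG
    obtain ⟨hle, ρ, hρ, hρs, hk⟩ := hst
    have hπK := hπ.comp_inclusion hle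
    have h0 : π ≠ 0 := by
      rintro rfl
      obtain ⟨x, hx⟩ := hs 1
      simp at hx
    -- If `π` kills the kernel of `ρ`, it factors through the last quotient: this is the case of
    -- equality. Otherwise the inequality will turn out to be strict.
    by_cases hz : π.comp (Submodule.inclusion hle) = 0
    · obtain ⟨n, hn, hn0, hker⟩ := hρ.factor hρs hπ (fun x hx =>
        LinearMap.congr_fun hz ⟨x.1, (hk x).1 hx⟩) h0
      rw [hn0 hs, Nat.cast_zero, add_zero] at hn
      exact ⟨_, hn.symm, le_rfl, fun _ x => ⟨fun hx => (hk x).1 (hker x hx),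
        fun hx => LinearMap.congr_fun hz ⟨x.1, hx⟩⟩⟩
    obtain ⟨p, π', hπ', hs', hp⟩ := hπK.exists_surjective hz
    obtain ⟨r, hr, hrle, -⟩ := ih h.init hK hπ' hs'
    obtain ⟨y, hy⟩ := hs' 1
    have hρy : ρ (Submodule.inclusion hle y) = 0 := (hk _).2 y.2
    have hπy : π (Submodule.inclusion hle y) = X ^ p := by
      have := hp y
      rwa [hy, mul_one] at this
    obtain ⟨e, he⟩ := hG
    -- For `p = 0`, `π y` would have constant term `1` while `ρ y = 0`, which cyclicity forbids.
    have hp0 : p ≠ 0 := by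
      rintro rfl
      have := he.constantCoeff_eq_zero hρ hρs hπ hρy
      rw [hπy] at this
      simp at this
    have hmono : μ (Fin.last k).castSucc ≤ μ (Fin.last (k + 1)) + 1 := by
      have := h.mono (Fin.le_last (Fin.last k).castSucc)
      simp only [Fin.val_last, Fin.val_castSucc] at this
      push_cast at this
      linarith
    have hp1 : (1 : ℝ) ≤ p := by exact_mod_cast Nat.one_le_iff_ne_zero.2 hp0
    have hzr : z = ((r - p : ℝ) : ℂ) := by
      push_cast
      rw [← hr]
      ring
    refine ⟨r - p, hzr, by linarith, fun heq => ?_⟩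
    exfalso
    have hpe : p = 1 := by
      have : (p : ℝ) ≤ 1 := by linarith
      exact le_antisymm (by exact_mod_cast this) (Nat.one_le_iff_ne_zero.2 hp0)
    subst hpe
    have hzμ : z = (μ (Fin.last (k + 1)) : ℂ) := by rw [hzr, heq]
    -- Here `π` and `ρ` have the same exponent and `π y = b` with `ρ y = 0`. The constant `c` makes
    -- the constant term of `π - c ρ` vanish at `e`, hence everywhere; dividing by `b` gives a
    -- morphism with value `1` at `y`, again excluded by cyclicity.
    set c : ℂ := constantCoeff (π e) / constantCoeff (ρ e) with hc
    let σ : (F (Fin.last (k + 1)).succ).carrier →ₗ[ℂ⟦X⟧] ℂ⟦X⟧ := π - (C c : ℂ⟦X⟧) • ρ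
    have hσ : IsHom z σ := fun x => by
      simp only [σ, LinearMap.sub_apply, LinearMap.smul_apply, smul_eq_mul, hπ x, hρ x, ← hzμ,
        RankOne.aFun, map_sub, Derivation.leibniz, derivative_C]
      ring
    have hσX : ∀ x, X ^ 1 ∣ σ x := fun x => by
      obtain ⟨d, hd⟩ := he.constantCoeff x
      rw [pow_one, X_dvd_iff, hd z σ hσ]
      simp only [σ, LinearMap.sub_apply, LinearMap.smul_apply, smul_eq_mul, map_sub, map_mul,
        PowerSeries.constantCoeff_C, hc]
      rw [div_mul_cancel₀ _ (he.constantCoeff_ne_zero hρ hρs), sub_self, mul_zero]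
    obtain ⟨σ', hσ'⟩ := exists_eq_X_pow_mul_of_dvd hσX
    have hσ'h := hσ.of_X_pow_mul hσ'
    have h1 : σ' (Submodule.inclusion hle y) = 1 := by
      refine mul_left_cancel₀ (pow_ne_zero 1 X_ne_zero) ?_
      rw [← hσ', mul_one, ← hπy]
      simp [σ, hρy]
    have := he.constantCoeff_eq_zero hρ hρs hσ'h hρy
    rw [h1] at this
    simp at this

/-- Applying `IsChain.le_last` to each filtration with the last quotient of the other gives equal
last exponents; its equality case then identifies the penultimate terms. -/
theorem IsChain.unique {k : ℕ} : ∀ {F F' : Fin (k + 1) → Sub E} {μ μ' : Fin k → ℝ},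
    IsChain F μ → IsChain F' μ' → F (Fin.last k) = F' (Fin.last k) →
    (∃ e : (F (Fin.last k)).carrier, IsGen e) → F = F' := by
  induction k with
  | zero =>
    intro F F' μ μ' h h' hl hG
    funext j
    rw [show j = Fin.last 0 from Fin.fin_one_eq_zero j, hl]
  | succ k ih =>
    intro F F' μ μ' h h' hl hG
    have hG' : ∃ e : (F' (Fin.last k).succ).carrier, IsGen e := by
      change ∃ e : (F' (Fin.last (k + 1))).carrier, IsGen e
      rw [← hl]
      exact hG
    have hle : ∀ {F F' : Fin (k + 2) → Sub E} {μ μ' : Fin (k + 1) → ℝ},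
        IsChain F μ → IsChain F' μ' → F (Fin.last k).succ = F' (Fin.last k).succ →
        (∃ e : (F' (Fin.last k).succ).carrier, IsGen e) →
        μ (Fin.last k) ≤ μ' (Fin.last k) ∧ (μ (Fin.last k) = μ' (Fin.last k) →
          F (Fin.last k).castSucc = F' (Fin.last k).castSucc) := by
      intro F F' μ μ' h h' hl hG'
      have hst := h.step (Fin.last k)
      rw [hl] at hst
      obtain ⟨hsub, π, hπ, hs, hk⟩ := hst
      obtain ⟨r, hr, hrle, hreq⟩ := h'.le_last hG' hπ hs
      obtain rfl : μ (Fin.last k) = r := by exact_mod_cast hr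
      refine ⟨hrle, fun heq => Sub.ext (Submodule.ext fun x => ?_)⟩
      constructor
      · intro hx
        exact (hreq heq ⟨x, hsub hx⟩).1 ((hk _).2 hx)
      · intro hx
        exact (hk ⟨x, (h'.step (Fin.last k)).1 hx⟩).1 ((hreq heq _).2 hx)
    obtain ⟨h1, h2⟩ := hle h h' hl hG'
    obtain ⟨h3, -⟩ := hle h' h hl.symm hG
    have hlast := h2 (le_antisymm h1 h3)
    have hinit := ih h.init h'.init hlast ((h.step (Fin.last k)).exists_isGen hG)
    funext j
    induction j using Fin.lastCases with
    | last => exact hl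
    | cast j => exact congrFun hinit j

end Chain

/-! ### Submodules of asymptotic expansions and the exponents of their quotients. -/

section Expansions

theorem Xi.a_apply {Λ : Finset ℚ} {N d : ℕ} (f : Xi Λ N d) (l : Λ) (j : Fin (N + 1))
    (i : Fin d) : a f l j i = RankOne.aFun ((l : ℚ) : ℂ) (f l j i)
      + C ((j : ℂ) + 1) * (X * f.next l j i) := rfl

theorem Xi.ext {Λ : Finset ℚ} {N d : ℕ} {f g : Xi Λ N d} (h : ∀ l j i, f l j i = g l j i) :
    f = g := funext fun l => funext fun j => funext fun i => h l j i

/-- The coefficient functionals. -/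
noncomputable def Xi.coord {Λ : Finset ℚ} {N d : ℕ} (l : Λ) (j : Fin (N + 1)) (i : Fin d) :
    Xi Λ N d →ₗ[ℂ⟦X⟧] ℂ⟦X⟧ where
  toFun f := f l j i
  map_add' _ _ := rfl
  map_smul' _ _ := rfl

variable {E : Type u} [AddCommGroup E] [Module ℂ⟦X⟧ E] [ABStructure E]

/-- If some coefficient of exponent `l` does not vanish on `E`, then `E` has a non-zero morphism to
`E_l`. -/
theorem exists_isHom_of_coord_ne_zero {Λ : Finset ℚ} {N d : ℕ} {ι : E →ₗ[ℂ⟦X⟧] Xi Λ N d}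
    (hι : ∀ x, ι (a x) = a (ι x)) (l : Λ) {x : E} {j : Fin (N + 1)} {i : Fin d}
    (hx : ι x l j i ≠ 0) :
    ∃ π : E →ₗ[ℂ⟦X⟧] ℂ⟦X⟧, IsHom ((l : ℚ) : ℂ) π ∧ π ≠ 0 := by
  classical
  -- At the highest power of `Log s` that occurs on `E` with exponent `l`, the term `next` vanishes,
  -- so the coordinates there are morphisms.
  let s : Finset (Fin (N + 1)) := Finset.univ.filter fun j => ∃ x i, ι x l j i ≠ 0
  have hs : s.Nonempty := ⟨j, by simpa [s] using ⟨x, i, hx⟩⟩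
  obtain ⟨y, i', hy⟩ : ∃ x i, ι x l (s.max' hs) i ≠ 0 := by
    simpa [s] using s.max'_mem hs
  refine ⟨(Xi.coord l (s.max' hs) i').comp ι, fun z => ?_, fun h => hy ?_⟩
  · change ι (a z) l (s.max' hs) i' = RankOne.aFun _ (ι z l (s.max' hs) i')
    rw [hι, Xi.a_apply]
    have : (ι z).next l (s.max' hs) i' = 0 := by
      rw [Xi.next]
      split_ifs with hlt
      · by_contra hne
        have hmem : (⟨(s.max' hs : ℕ) + 1, hlt⟩ : Fin (N + 1)) ∈ s := by
          simpa [s] using ⟨z, i', hne⟩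
        have h2 := Fin.le_iff_val_le_val.1 (s.le_max' _ hmem)
        exact absurd h2 (by simp)
      · rfl
    rw [this, mul_zero, mul_zero, add_zero]
  · exact LinearMap.congr_fun h y

/-- `b⁻¹ a - l` on expansions with the single exponent `l`. -/
noncomputable def Xi.nil {l : ℚ} {N d : ℕ} (f : Xi {l} N d) : Xi {l} N d := fun m j i =>
  X * derivative ℂ (f m j i) + C ((j : ℂ) + 1) * f.next m j i

theorem Xi.a_eq {l : ℚ} {N d : ℕ} (f : Xi {l} N d) :
    a f = (X : ℂ⟦X⟧) • f.nil + (C (l : ℂ) * X : ℂ⟦X⟧) • f := by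
  refine Xi.ext fun m j i => ?_
  obtain ⟨m, hm⟩ := m
  obtain rfl : m = l := Finset.mem_singleton.1 hm
  change a f _ j i = X * (f.nil _ j i) + C (m : ℂ) * X * f _ j i
  rw [Xi.a_apply, RankOne.aFun, Xi.nil]
  ring

/-- Modulo `b`, `Xi.nil` only lowers the power of `Log s`, so it is nilpotent of order at most `N +
1`. -/
theorem Xi.iterate_nil {l : ℚ} {N d : ℕ} (f : Xi {l} N d) :
    ∃ g : Xi {l} N d, Xi.nil^[N + 1] f = (X : ℂ⟦X⟧) • g := by
  have key : ∀ (n : ℕ) m (j : Fin (N + 1)) i, N < (j : ℕ) + n →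
      constantCoeff ((Xi.nil^[n] f) m j i) = 0 := by
    intro n
    induction n with
    | zero => intro m j i h; have := j.2; omega
    | succ n ih =>
      intro m j i h
      rw [Function.iterate_succ_apply', Xi.nil, map_add, map_mul, map_mul, constantCoeff_X,
        zero_mul, zero_add, Xi.next]
      split_ifs with hlt
      · rw [ih _ _ _ (by simp only; omega), mul_zero]
      · rw [map_zero, mul_zero]
  have hd : ∀ m j i, ∃ g, (Xi.nil^[N + 1] f) m j i = X * g := fun m j i =>
    X_dvd_iff.2 (key (N + 1) m j i (by omega))
  choose g hg using hd
  exact ⟨g, Xi.ext hg⟩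

/-- `E` embeds in some `Ξ_{l}^(N) ⊗ V`. -/
def Embeds (l : ℚ) (E : Type u) [AddCommGroup E] [Module ℂ⟦X⟧ E] [ABStructure E] : Prop :=
  ∃ (N d : ℕ) (ι : E →ₗ[ℂ⟦X⟧] Xi {l} N d), Function.Injective ι ∧ ∀ x, ι (a x) = a (ι x)

instance (Λ : Finset ℚ) (N d : ℕ) : Module.Finite ℂ⟦X⟧ (Xi Λ N d) :=
  inferInstanceAs (Module.Finite ℂ⟦X⟧ (Λ → Fin (N + 1) → Fin d → ℂ⟦X⟧))

instance (Λ : Finset ℚ) (N d : ℕ) : Module.Free ℂ⟦X⟧ (Xi Λ N d) :=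
  inferInstanceAs (Module.Free ℂ⟦X⟧ (Λ → Fin (N + 1) → Fin d → ℂ⟦X⟧))

theorem Embeds.finite {l : ℚ} (h : Embeds l E) : Module.Finite ℂ⟦X⟧ E := by
  obtain ⟨N, d, ι, hi, -⟩ := h
  exact Module.Finite.of_injective ι hi

theorem Embeds.isTorsionFree {l : ℚ} (h : Embeds l E) : Module.IsTorsionFree ℂ⟦X⟧ E := by
  obtain ⟨N, d, ι, hi, -⟩ := h
  exact hi.moduleIsTorsionFree ι fun S x => map_smul ι S x

theorem Embeds.sub {l : ℚ} (h : Embeds l E) (G : Sub E) : Embeds l G.carrier := by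
  obtain ⟨N, d, ι, hi, ha⟩ := h
  exact ⟨N, d, ι.comp G.carrier.subtype, hi.comp Subtype.val_injective, fun x => ha x.1⟩

theorem Embeds.exists_isHom {l : ℚ} (h : Embeds l E) {x : E} (hx : x ≠ 0) :
    ∃ (n : ℕ) (π : E →ₗ[ℂ⟦X⟧] ℂ⟦X⟧), IsHom ((l : ℂ) + n) π ∧ Function.Surjective π := by
  obtain ⟨N, d, ι, hi, ha⟩ := h
  obtain ⟨m, j, i, hne⟩ : ∃ m j i, ι x m j i ≠ 0 := by
    by_contra! hc
    exact hx (hi (by rw [map_zero]; exact Xi.ext hc))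
  obtain ⟨π, hπ, h0⟩ := exists_isHom_of_coord_ne_zero ha m hne
  rw [Finset.mem_singleton.1 m.2] at hπ
  obtain ⟨n, π', h1, h2, -⟩ := hπ.exists_surjective h0
  exact ⟨n, π', h1, h2⟩

/-- The elements of `Ξ` with a multiple by a power of `b` in the image of `E`. -/
noncomputable def hull {Λ : Finset ℚ} {N d : ℕ} (ι : E →ₗ[ℂ⟦X⟧] Xi Λ N d)
    (ha : ∀ x, ι (a x) = a (ι x)) : Sub (Xi Λ N d) where
  carrier :=
    { carrier := {y | ∃ n : ℕ, (X ^ n : ℂ⟦X⟧) • y ∈ LinearMap.range ι}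
      zero_mem' := ⟨0, by simp⟩
      add_mem' := by
        rintro y y' ⟨n, hn⟩ ⟨n', hn'⟩
        refine ⟨n + n', ?_⟩
        rw [smul_add]
        refine Submodule.add_mem _ ?_ ?_
        · rw [add_comm, pow_add, mul_smul]
          exact Submodule.smul_mem _ _ hn
        · rw [pow_add, mul_smul]
          exact Submodule.smul_mem _ _ hn'
      smul_mem' := by
        rintro S y ⟨n, hn⟩
        exact ⟨n, by rw [smul_comm]; exact Submodule.smul_mem _ _ hn⟩ }
  a_mem := by
    rintro y ⟨n, x, hx⟩
    -- From `b^(n+1) a y = b a (b^n y) - n b² (b^n y)`.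
    refine ⟨n + 1, (X : ℂ⟦X⟧) • a x - (X ^ 2 * (n : ℂ⟦X⟧)) • x, ?_⟩
    rw [map_sub, map_smul, map_smul, ha, hx, a_smul, smul_add, smul_smul, smul_smul, smul_smul,
      ← pow_succ', add_sub_assoc, ← sub_smul]
    convert add_zero _
    rw [show (X * (X ^ 2 * derivative ℂ (X ^ n)) - X ^ 2 * (n : ℂ⟦X⟧) * X ^ n : ℂ⟦X⟧) = 0 by
      linear_combination X ^ 2 * X_mul_derivative_X_pow n, zero_smul]

/-- The exponents of the rank one quotients of a submodule of `Ξ_{l}^(N) ⊗ V` are in `l + ℕ`. -/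
theorem Embeds.exists_eq_add_nat {l : ℚ} (h : Embeds l E) {z : ℂ} {π : E →ₗ[ℂ⟦X⟧] ℂ⟦X⟧}
    (hπ : IsHom z π) (hs : Function.Surjective π) : ∃ n : ℕ, z = (l : ℂ) + n := by
  obtain ⟨N, d, ι, hi, ha⟩ := h
  -- The hull `H` is stable by `b⁻¹ a - l`, and `b^n H ⊆ R` for some `n` by noetherianity. So `π ∘
  -- b^n` is a morphism from `H` to `E_(z-n)`; dividing it by `b^p` makes it surjective, with `p ≤
  -- n` because it takes the value `b^n`. On constant terms `b⁻¹ a - l` then acts as `z - n + p -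
  -- l`, which nilpotence modulo `b` forces to be `0`.
  let R : Submodule ℂ⟦X⟧ (Xi {l} N d) := LinearMap.range ι
  let H : Submodule ℂ⟦X⟧ (Xi {l} N d) := (hull ι ha).carrier
  have hHX : ∀ y, (X : ℂ⟦X⟧) • y ∈ H → y ∈ H := by
    rintro y ⟨n, hn⟩
    exact ⟨n + 1, by rwa [pow_succ, mul_smul]⟩
  have hHa : ∀ y ∈ H, a y ∈ H := (hull ι ha).a_mem
  have hHnil : ∀ y ∈ H, y.nil ∈ H := by
    intro y hy
    refine hHX _ ?_
    rw [show (X : ℂ⟦X⟧) • y.nil = a y - (C (l : ℂ) * X : ℂ⟦X⟧) • y by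
      rw [Xi.a_eq, add_sub_cancel_right]]
    exact H.sub_mem (hHa y hy) (H.smul_mem _ hy)
  obtain ⟨n, hn⟩ : ∃ n : ℕ, ∀ y ∈ H, (X ^ n : ℂ⟦X⟧) • y ∈ R := by
    obtain ⟨s, hsH⟩ : H.FG := IsNoetherian.noetherian H
    have hex : ∀ y ∈ s, ∃ n : ℕ, (X ^ n : ℂ⟦X⟧) • y ∈ R := fun y hy => by
      have : y ∈ H := hsH ▸ Submodule.subset_span hy
      exact this
    choose! f hf using hex
    refine ⟨s.sup f, fun y hy => ?_⟩
    rw [← hsH] at hy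
    have hle : Submodule.span ℂ⟦X⟧ (s : Set (Xi {l} N d)) ≤
        R.comap (LinearMap.lsmul ℂ⟦X⟧ (Xi {l} N d) (X ^ s.sup f : ℂ⟦X⟧)) := by
      refine Submodule.span_le.2 fun y hy => ?_
      change (X ^ s.sup f : ℂ⟦X⟧) • y ∈ R
      rw [← Nat.sub_add_cancel (Finset.le_sup hy : f y ≤ s.sup f), pow_add, mul_smul]
      exact R.smul_mem _ (hf y hy)
    exact hle hy
  choose g hg using hn
  let ρ : (hull ι ha).carrier →ₗ[ℂ⟦X⟧] ℂ⟦X⟧ :=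
    { toFun := fun y => π (g y.1 y.2)
      map_add' := fun y y' => by
        rw [← map_add]
        exact congrArg π (hi (by rw [map_add, hg, hg, hg, ← smul_add]; rfl))
      map_smul' := fun S y => by
        rw [RingHom.id_apply, ← map_smul]
        exact congrArg π (hi (by rw [map_smul, hg, hg, smul_comm]; rfl)) }
  have hι : ∀ x, ι x ∈ H := fun x => ⟨0, x, by simp⟩
  have hρι : ∀ x, ρ ⟨ι x, hι x⟩ = X ^ n * π x := fun x => by
    rw [← smul_eq_mul, ← map_smul]
    exact congrArg π (hi (by rw [hg, map_smul]))
  have hρ : IsHom (z - n) ρ := by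
    intro y
    have h1 : a (g y.1 y.2) = g (a y).1 (a y).2 + ((n : ℂ⟦X⟧) * X) • g y.1 y.2 := by
      refine hi ?_
      rw [ha, map_add, map_smul, hg, hg, a_smul, smul_smul]
      congr 2
      linear_combination X * X_mul_derivative_X_pow n
    have h2 : ρ (a y) = π (a (g y.1 y.2)) - ((n : ℂ⟦X⟧) * X) * ρ y := by
      rw [h1, map_add, map_smul, smul_eq_mul]
      exact (add_sub_cancel_right _ _).symm
    rw [h2, hπ]
    change RankOne.aFun z (ρ y) - _ = _
    simp only [RankOne.aFun, map_sub, map_natCast]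
    ring
  have hρ0 : ρ ≠ 0 := by
    intro h0
    obtain ⟨x, hx⟩ := hs 1
    have := hρι x
    rw [h0, hx, mul_one] at this
    exact pow_ne_zero n X_ne_zero this.symm
  obtain ⟨p, ρ', hρ', hs', hp⟩ := hρ.exists_surjective hρ0
  have hpn : p ≤ n := by
    obtain ⟨x, hx⟩ := hs 1
    have h1 := hp ⟨ι x, hι x⟩
    rw [hρι, hx, mul_one] at h1
    have h2 : (X ^ p : ℂ⟦X⟧) ∣ X ^ n := ⟨_, h1⟩
    by_contra hlt
    have := X_pow_dvd_iff.1 h2 n (not_le.1 hlt)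
    simp [coeff_X_pow] at this
  have hnil : ∀ (y : (hull ι ha).carrier) (hy : y.1.nil ∈ H), constantCoeff (ρ' ⟨y.1.nil, hy⟩) =
      (z - n + p - l) * constantCoeff (ρ' y) := by
    intro y hy
    have h1 : a y = (X : ℂ⟦X⟧) • (⟨y.1.nil, hy⟩ : (hull ι ha).carrier) + (C (l : ℂ) * X : ℂ⟦X⟧) • y :=
      Subtype.ext (Xi.a_eq y.1)
    have h2 := congrArg (coeff (0 + 1)) (hρ' y)
    rw [RankOne.coeff_succ_aFun, h1, map_add, map_smul, map_smul, smul_eq_mul, smul_eq_mul,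
      map_add, coeff_succ_X_mul, mul_assoc, coeff_C_mul, coeff_succ_X_mul] at h2
    simp only [coeff_zero_eq_constantCoeff_apply, Nat.cast_zero, zero_add] at h2
    linear_combination h2
  obtain ⟨y, hy⟩ := hs' 1
  have hiter : ∀ m : ℕ, ∃ hm : Xi.nil^[m] y.1 ∈ H, constantCoeff (ρ' ⟨_, hm⟩) =
      (z - n + p - l) ^ m := by
    intro m
    induction m with
    | zero => exact ⟨y.2, by rw [pow_zero]; exact (congrArg constantCoeff hy).trans (by simp)⟩
    | succ m ih =>
      obtain ⟨hm, he⟩ := ih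
      simp only [Function.iterate_succ_apply']
      exact ⟨hHnil _ hm, by rw [hnil ⟨_, hm⟩, he, pow_succ']⟩
  obtain ⟨hm, he⟩ := hiter (N + 1)
  obtain ⟨w, hw⟩ := Xi.iterate_nil y.1
  have hwH : w ∈ H := hHX w (hw ▸ hm)
  have h0 : constantCoeff (ρ' ⟨_, hm⟩) = 0 := by
    rw [show (⟨_, hm⟩ : (hull ι ha).carrier) = (X : ℂ⟦X⟧) • (⟨w, hwH⟩ : (hull ι ha).carrier) from
      Subtype.ext hw, map_smul, smul_eq_mul, map_mul, constantCoeff_X, zero_mul]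
  rw [h0] at he
  have hz := pow_eq_zero_iff (Nat.succ_ne_zero N) |>.1 he.symm
  refine ⟨n - p, ?_⟩
  rw [Nat.cast_sub hpn]
  linear_combination hz

end Expansions

/-! ### From morphisms to roots of the Bernstein polynomial; reduction to one exponent. -/

section Saturation

variable {E : Type u} [AddCommGroup E] [Module ℂ⟦X⟧ E]

/-- `t` is the value at `w` of the extension of `π` to `E[b⁻¹]`. -/
def LocValue (π : E →ₗ[ℂ⟦X⟧] ℂ⟦X⟧) (w : Loc E) (t : ℂ⟦X⟧) : Prop :=
  ∃ (x : E) (s : Submonoid.powers (X : ℂ⟦X⟧)), w = LocalizedModule.mk x s ∧ π x = s * t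

theorem powers_X_ne_zero (s : Submonoid.powers (X : ℂ⟦X⟧)) : (s : ℂ⟦X⟧) ≠ 0 := by
  obtain ⟨_, n, rfl⟩ := s
  exact pow_ne_zero n X_ne_zero

theorem LocValue.unique {π : E →ₗ[ℂ⟦X⟧] ℂ⟦X⟧} {w : Loc E} {t t' : ℂ⟦X⟧} (h : LocValue π w t)
    (h' : LocValue π w t') : t = t' := by
  obtain ⟨x, s, rfl, hx⟩ := h
  obtain ⟨x', s', he, hx'⟩ := h'
  obtain ⟨v, hv⟩ := LocalizedModule.mk_eq.1 he
  have := congrArg π hv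
  simp only [Submonoid.smul_def, map_smul, smul_eq_mul, hx, hx'] at this
  have h0 := mul_ne_zero (powers_X_ne_zero v)
    (mul_ne_zero (powers_X_ne_zero s) (powers_X_ne_zero s'))
  refine mul_left_cancel₀ h0 ?_
  linear_combination this

theorem LocValue.add {π : E →ₗ[ℂ⟦X⟧] ℂ⟦X⟧} {w w' : Loc E} {t t' : ℂ⟦X⟧} (h : LocValue π w t)
    (h' : LocValue π w' t') : LocValue π (w + w') (t + t') := by
  obtain ⟨x, s, rfl, hx⟩ := h
  obtain ⟨x', s', rfl, hx'⟩ := h'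
  refine ⟨_, _, LocalizedModule.mk_add_mk, ?_⟩
  simp only [Submonoid.smul_def, map_add, map_smul, smul_eq_mul, hx, hx', Submonoid.coe_mul]
  ring

theorem LocValue.smul {π : E →ₗ[ℂ⟦X⟧] ℂ⟦X⟧} {w : Loc E} {t : ℂ⟦X⟧} (h : LocValue π w t)
    (S : ℂ⟦X⟧) : LocValue π (S • w) (S * t) := by
  obtain ⟨x, s, rfl, hx⟩ := h
  refine ⟨S • x, s, by rw [LocalizedModule.smul'_mk], ?_⟩
  rw [map_smul, smul_eq_mul, hx]
  ring

theorem locValue_mk_one (π : E →ₗ[ℂ⟦X⟧] ℂ⟦X⟧) (x : E) :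
    LocValue π (LocalizedModule.mk x 1) (π x) :=
  ⟨x, 1, rfl, by simp⟩

variable [ABStructure E]

theorem LocValue.theta {z : ℂ} {π : E →ₗ[ℂ⟦X⟧] ℂ⟦X⟧} (hπ : IsHom z π) {w : Loc E} {t : ℂ⟦X⟧}
    (h : LocValue π w t) : LocValue π (theta E w) (X * derivative ℂ t + C z * t) := by
  obtain ⟨x, s, rfl, hx⟩ := h
  refine ⟨s • a x - (X ^ 2 * derivative ℂ (s : ℂ⟦X⟧)) • x, bDen * (s * s), ?_, ?_⟩
  · change thetaAux (x, s) = _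
    rw [thetaAux, sub_eq_iff_eq_add, LocalizedModule.mk_add_mk, LocalizedModule.mk_eq]
    refine ⟨1, ?_⟩
    simp only [Submonoid.smul_def, smul_add, smul_sub, smul_smul, Submonoid.coe_mul,
      Submonoid.coe_one, bDen]
    rw [← sub_eq_zero]
    have : ∀ (A B D F : ℂ⟦X⟧) (y : E), A = B → D = F →
        A • y - (B • y - D • x + F • x) = 0 := by
      rintro A B D F y rfl rfl
      abel
    exact this _ _ _ _ _ (by ring) (by ring)
  · simp only [Submonoid.smul_def, map_sub, map_smul, smul_eq_mul, hπ x, hx, RankOne.aFun,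
      Derivation.leibniz, Submonoid.coe_mul, bDen]
    ring

/-- Since `E_z` is already stable by `b⁻¹ a`, the elements of `E[b⁻¹]` with value in `ℂ[[b]]` form
one of the submodules whose intersection is the saturation. -/
theorem exists_locValue {z : ℂ} {π : E →ₗ[ℂ⟦X⟧] ℂ⟦X⟧} (hπ : IsHom z π) (w : saturation E) :
    ∃ t, LocValue π w.1 t := by
  let M : Submodule ℂ⟦X⟧ (Loc E) :=
    { carrier := {w | ∃ t, LocValue π w t}
      zero_mem' := ⟨0, 0, 1, (LocalizedModule.zero_mk 1).symm, by simp⟩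
      add_mem' := fun ⟨t, ht⟩ ⟨t', ht'⟩ => ⟨_, ht.add ht'⟩
      smul_mem' := fun S _ ⟨t, ht⟩ => ⟨_, ht.smul S⟩ }
  exact Submodule.mem_sInf.1 w.2 M ⟨fun x => ⟨_, locValue_mk_one π x⟩,
    fun _ ⟨t, ht⟩ => ⟨_, ht.theta hπ⟩⟩

/-- A morphism to `E_z` extends to the saturation. -/
theorem IsHom.exists_extension {z : ℂ} {π : E →ₗ[ℂ⟦X⟧] ℂ⟦X⟧} (hπ : IsHom z π) :
    ∃ ρ : saturation E →ₗ[ℂ⟦X⟧] ℂ⟦X⟧, (∀ w, X * ρ (thetaSat E w) = RankOne.aFun z (ρ w)) ∧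
      (π ≠ 0 → ρ ≠ 0) := by
  choose f hf using exists_locValue hπ
  refine ⟨⟨⟨f, fun w w' => (hf _).unique ((hf w).add (hf w'))⟩,
    fun S w => (hf _).unique ((hf w).smul S)⟩, fun w => ?_, fun h0 h => h0 ?_⟩
  · change X * f (thetaSat E w) = RankOne.aFun z (f w)
    rw [(hf (thetaSat E w)).unique ((hf w).theta hπ), RankOne.aFun]
    ring
  · refine LinearMap.ext fun x => ?_
    have hx : LocalizedModule.mk x 1 ∈ saturation E :=
      Submodule.mem_sInf.2 fun M hM => hM.1 x
    rw [(locValue_mk_one π x).unique (hf ⟨_, hx⟩)]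
    exact LinearMap.congr_fun h ⟨_, hx⟩

/-- A non-zero morphism to `E_z` gives a root of the Bernstein polynomial. -/
theorem IsHom.exists_isRoot {z : ℂ} {π : E →ₗ[ℂ⟦X⟧] ℂ⟦X⟧} (hπ : IsHom z π) (h0 : π ≠ 0) :
    ∃ p : ℕ, (bernsteinPolynomial E).IsRoot (-(z + p)) := by
  obtain ⟨ρ, hρ, hρ0⟩ := hπ.exists_extension
  obtain ⟨p, σ, hσs, hσ⟩ := exists_eq_X_pow_mul (hρ0 h0)
  have hθ : ∀ w, constantCoeff (σ (thetaSat E w)) = (z + p) * constantCoeff (σ w) := fun w => by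
    have h1 : X * σ (thetaSat E w) = RankOne.aFun (z + p) (σ w) := by
      refine mul_left_cancel₀ (pow_ne_zero p X_ne_zero) ?_
      rw [← RankOne.aFun_X_pow_mul, ← hσ, ← hρ, hσ]
      ring
    have h2 := congrArg (coeff (0 + 1)) h1
    rw [RankOne.coeff_succ_aFun, coeff_succ_X_mul] at h2
    simpa using h2
  -- The constant term of `σ` is a nonzero linear form on `E♯ / bE♯`, an eigenvector of the
  -- transpose of `-b⁻¹ a` with eigenvalue `-(z + p)`. Any polynomial annihilating the endomorphism
  -- vanishes there.
  let τ : SatQuot E →ₗ[ℂ] ℂ :=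
    { toFun := QuotientAddGroup.lift
        ((X : ℂ⟦X⟧) • (⊤ : Submodule ℂ⟦X⟧ (saturation E))).toAddSubgroup
        ((constantCoeff (R := ℂ)).toAddMonoidHom.comp σ.toAddMonoidHom) (by
          intro w hw
          obtain ⟨v, -, rfl⟩ := (Submodule.mem_smul_pointwise_iff_exists _ _ _).1 hw
          change constantCoeff (σ ((X : ℂ⟦X⟧) • v)) = 0
          rw [map_smul, smul_eq_mul, map_mul, constantCoeff_X, zero_mul])
      map_add' := map_add _
      map_smul' := fun c w => by
        obtain ⟨w, rfl⟩ := Submodule.Quotient.mk_surjective _ w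
        change constantCoeff (σ ((C c : ℂ⟦X⟧) • w)) = c * constantCoeff (σ w)
        rw [map_smul, smul_eq_mul, map_mul, constantCoeff_C] }
  have hτ : ∀ w, τ ((-thetaBar E) w) = -(z + p) * τ w := fun w => by
    rw [LinearMap.neg_apply, map_neg, neg_mul, neg_inj]
    obtain ⟨w, rfl⟩ := Submodule.Quotient.mk_surjective _ w
    exact hθ w
  have haeval : ∀ (Q : Polynomial ℂ) w, τ (Polynomial.aeval (-thetaBar E) Q w) =
      Q.eval (-(z + p)) * τ w := by
    intro Q w
    induction Q using Polynomial.induction_on' with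
    | add Q R hQ hR => rw [map_add, LinearMap.add_apply, map_add, hQ, hR, Polynomial.eval_add, add_mul]
    | monomial n c =>
      rw [Polynomial.aeval_monomial, Polynomial.eval_monomial, Module.algebraMap_end_eq_smul_id,
        Module.End.mul_apply, LinearMap.smul_apply, LinearMap.id_apply, map_smul, smul_eq_mul,
        mul_assoc]
      congr 1
      induction n with
      | zero => simp
      | succ n ih => rw [pow_succ', Module.End.mul_apply, hτ, ih, pow_succ', mul_assoc]
  obtain ⟨w, hw⟩ := hσs 1
  refine ⟨p, ?_⟩
  have h := haeval (bernsteinPolynomial E) (Submodule.Quotient.mk w)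
  rw [bernsteinPolynomial, minpoly.aeval, LinearMap.zero_apply, map_zero] at h
  have hone : τ (Submodule.Quotient.mk w) = 1 := by
    change constantCoeff (σ w) = 1
    rw [hw, map_one]
  rw [hone, mul_one] at h
  exact h.symm

/-- A primitive submodule of `Ξ_Λ^(N) ⊗ V` only involves the exponent `l`. -/
theorem IsFresco.embeds (hE : IsFresco E) {l : ℚ} (hl0 : 0 < l) (hl1 : l ≤ 1)
    (hprim : IsPrimitive E l) : Embeds l E := by
  classical
  obtain ⟨Λ, N, d, φ, hΛ, ⟨ψ⟩⟩ := hE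
  let ι : E →ₗ[ℂ⟦X⟧] Xi Λ N d :=
    (cyclic φ).carrier.subtype.comp (ψ.toLinearEquiv : E →ₗ[ℂ⟦X⟧] (cyclic φ).carrier)
  have hi : Function.Injective ι := Subtype.val_injective.comp ψ.toLinearEquiv.injective
  have ha : ∀ x, ι (a x) = a (ι x) := fun x => congrArg Subtype.val (ψ.map_a x)
  -- A nonzero coordinate of exponent `m` yields a root `-(m + p)`, so `m - l` is an integer; as
  -- both lie in `]0,1]`, `m = l`.
  have hvan : ∀ x (m : Λ) j i, (m : ℚ) ≠ l → ι x m j i = 0 := by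
    intro x m j i hne
    by_contra hx
    obtain ⟨π, hπ, h0⟩ := exists_isHom_of_coord_ne_zero ha m hx
    obtain ⟨p, hp⟩ := hπ.exists_isRoot h0
    obtain ⟨n, hn⟩ := hprim _ hp
    have hn' : (m : ℚ) = l + (-n - p : ℤ) := by
      have : ((m : ℚ) : ℂ) = ((l + (-n - p : ℤ) : ℚ) : ℂ) := by
        push_cast
        linear_combination -hn
      exact_mod_cast this
    obtain ⟨h1, h2⟩ := hΛ m m.2
    have h3 : ((-n - p : ℤ) : ℚ) < 1 := by linarith
    have h4 : (-1 : ℚ) < ((-n - p : ℤ) : ℚ) := by linarith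
    have h5 : (-n - p : ℤ) < 1 := by exact_mod_cast h3
    have h6 : (-1 : ℤ) < -n - p := by exact_mod_cast h4
    have h7 : (-n - p : ℤ) = 0 := by omega
    rw [h7, Int.cast_zero, add_zero] at hn'
    exact hne hn'
  -- Projection to the exponent `l`. The value `0` is taken when `l ∉ Λ`, in which case `E = 0` by
  -- `hvan`.
  let P : Xi Λ N d →ₗ[ℂ⟦X⟧] Xi {l} N d :=
    { toFun := fun f m j i => if h : (m : ℚ) ∈ Λ then f ⟨m, h⟩ j i else 0
      map_add' := fun f g => Xi.ext fun m j i => by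
        change (if h : (m : ℚ) ∈ Λ then (f ⟨m, h⟩ j i + g ⟨m, h⟩ j i : ℂ⟦X⟧) else 0) =
          (if h : (m : ℚ) ∈ Λ then f ⟨m, h⟩ j i else 0) +
            if h : (m : ℚ) ∈ Λ then g ⟨m, h⟩ j i else 0
        split_ifs <;> simp
      map_smul' := fun S f => Xi.ext fun m j i => by
        change (if h : (m : ℚ) ∈ Λ then (S * f ⟨m, h⟩ j i : ℂ⟦X⟧) else 0) =
          S * if h : (m : ℚ) ∈ Λ then f ⟨m, h⟩ j i else 0
        split_ifs <;> simp }
  have hP : ∀ f m j i, P f m j i = if h : (m : ℚ) ∈ Λ then f ⟨m, h⟩ j i else 0 :=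
    fun _ _ _ _ => rfl
  have hPa : ∀ f, P (a f) = a (P f) := fun f => Xi.ext fun m j i => by
    simp only [Xi.a_apply, hP, Xi.next]
    split_ifs <;> simp [RankOne.aFun]
  refine ⟨N, d, P.comp ι, (injective_iff_map_eq_zero _).2 fun x hx => ?_, fun x => ?_⟩
  · refine hi ?_
    rw [map_zero]
    refine Xi.ext fun m j i => ?_
    by_cases hm : (m : ℚ) = l
    · have := congrFun (congrFun (congrFun hx ⟨m, Finset.mem_singleton.2 hm⟩) j) i
      change P (ι x) _ j i = 0 at this
      rwa [hP, dif_pos m.2] at this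
    · exact hvan x m j i hm
  · change P (ι (a x)) = a (P (ι x))
    rw [ha, hPa]

theorem IsFresco.exists_isGen (hE : IsFresco E) : ∃ e : E, IsGen e := by
  obtain ⟨Λ, N, d, φ, -, ⟨ψ⟩⟩ := hE
  have hφ : φ ∈ (cyclic φ).carrier := Submodule.mem_sInf.2 fun M hM => hM.1
  refine ⟨ψ.toLinearEquiv.symm ⟨φ, hφ⟩, fun M hM ha => eq_top_iff.2 fun x _ => ?_⟩
  let M' : Submodule ℂ⟦X⟧ (Xi Λ N d) :=
    (M.map (ψ.toLinearEquiv : E →ₗ[ℂ⟦X⟧] (cyclic φ).carrier)).map (cyclic φ).carrier.subtype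
  have hle : (cyclic φ).carrier ≤ M' := by
    refine sInf_le ⟨⟨_, ⟨_, hM, rfl⟩, by simp⟩, ?_⟩
    rintro _ ⟨_, ⟨y, hy, rfl⟩, rfl⟩
    exact ⟨_, ⟨a y, ha y hy, rfl⟩, congrArg Subtype.val (ψ.map_a y)⟩
  obtain ⟨_, ⟨y, hy, rfl⟩, hyx⟩ := hle (ψ.toLinearEquiv x).2
  have := ψ.toLinearEquiv.injective (Subtype.ext hyx)
  rwa [← this]

end Saturation

/-! ### Existence of the principal filtration. -/

section Existence

variable {E : Type u} [AddCommGroup E] [Module ℂ⟦X⟧ E] [ABStructure E]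

theorem Step.finrank {F G : Sub E} {z : ℂ} (h : Step F G z) [Module.Finite ℂ⟦X⟧ G.carrier] :
    Module.finrank ℂ⟦X⟧ G.carrier = Module.finrank ℂ⟦X⟧ F.carrier + 1 := by
  obtain ⟨hle, π, -, hs, hk⟩ := h
  have h1 := Submodule.finrank_quotient_add_finrank (LinearMap.ker π)
  rw [(π.quotKerEquivOfSurjective hs).finrank_eq, Module.finrank_self] at h1
  have h2 : LinearMap.ker π = F.carrier.comap G.carrier.subtype := Submodule.ext hk
  rw [h2, (Submodule.comapSubtypeEquivOfLe hle).finrank_eq] at h1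
  omega

theorem Embeds.carrier_eq_bot {l : ℚ} (hE : Embeds l E) {G : Sub E}
    (h : Module.finrank ℂ⟦X⟧ G.carrier = 0) : G.carrier = ⊥ := by
  have := (hE.sub G).finite
  have := (hE.sub G).isTorsionFree
  have := Module.finrank_eq_zero_iff.1 h
  refine (Submodule.eq_bot_iff _).2 fun x hx => ?_
  obtain ⟨S, hS, h0⟩ := this ⟨x, hx⟩
  exact congrArg Subtype.val ((smul_eq_zero.1 h0).resolve_left hS)

theorem Embeds.exists_isHom_sub {l : ℚ} (hE : Embeds l E) {G : Sub E}
    (h : Module.finrank ℂ⟦X⟧ G.carrier ≠ 0) :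
    ∃ (n : ℕ) (π : G.carrier →ₗ[ℂ⟦X⟧] ℂ⟦X⟧), IsHom ((l : ℂ) + n) π ∧ Function.Surjective π := by
  have : ∃ x : G.carrier, x ≠ 0 := by
    by_contra! hc
    have : Subsingleton G.carrier := ⟨fun x y => by rw [hc x, hc y]⟩
    exact h Module.finrank_zero_of_subsingleton
  obtain ⟨x, hx⟩ := this
  exact (hE.sub G).exists_isHom hx

/-- The exponents of the rank one quotients are bounded. -/
theorem Embeds.exists_bound {l : ℚ} (hE : Embeds l E) (k : ℕ) : ∀ G : Sub E,
    Module.finrank ℂ⟦X⟧ G.carrier = k → ∃ B : ℕ, ∀ (n : ℕ) (π : G.carrier →ₗ[ℂ⟦X⟧] ℂ⟦X⟧),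
      IsHom ((l : ℂ) + n) π → π ≠ 0 → n ≤ B := by
  induction k with
  | zero =>
    refine fun G hG => ⟨0, fun n π _ h0 => (h0 (LinearMap.ext fun x => ?_)).elim⟩
    have hx : x = 0 := Subtype.ext ((Submodule.eq_bot_iff _).1 (hE.carrier_eq_bot hG) _ x.2)
    rw [hx, map_zero, map_zero]
  | succ k ih =>
    intro G hG
    obtain ⟨m, ρ, hρ, hs⟩ := hE.exists_isHom_sub (G := G) (by omega)
    have := (hE.sub G).finite
    have hst := step_kerSub hρ hs
    obtain ⟨B, hB⟩ := ih (kerSub G hρ) (by have := hst.finrank; omega)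
    refine ⟨max m B, fun n π hπ h0 => ?_⟩
    -- Either `π` factors through `ρ`, and `n ≤ m`, or it stays nonzero on the kernel. Bounding all
    -- nonzero morphisms, not just surjective ones, lets the induction apply to this restriction.
    by_cases hz : π.comp (Submodule.inclusion (kerSub_le hρ)) = 0
    · obtain ⟨i, hi, -⟩ := hρ.factor hs hπ (fun x hx =>
        LinearMap.congr_fun hz ⟨x.1, (mem_kerSub hρ x).2 hx⟩) h0
      rw [add_assoc, add_right_inj] at hi
      have : m = n + i := by exact_mod_cast hi
      omega
    · exact (hB n _ (hπ.comp_inclusion _) hz).trans (le_max_right _ _)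

/-- The exchange of two successive quotients of a cyclic module. -/
theorem Step.exchange {F K G : Sub E} {z : ℂ} {n : ℕ} (hF : Step F K (z + (n + 1) + 1))
    (hK : Step K G z) (hG : ∃ e : G.carrier, IsGen e) :
    ∃ ψ : G.carrier →ₗ[ℂ⟦X⟧] ℂ⟦X⟧, IsHom (z + (n + 1)) ψ ∧ Function.Surjective ψ := by
  obtain ⟨hle, π, hπ, hs, hk⟩ := hK
  obtain ⟨-, ρ, hρ, hρs, -⟩ := hF
  obtain ⟨e, he⟩ := hG
  obtain ⟨e, he, h1⟩ := he.exists_map_eq_one hπ hs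
  obtain ⟨f, hfe, hf⟩ := he.ker hle hπ hk h1
  let r : (K.restrict G).carrier →ₗ[ℂ⟦X⟧] K.carrier :=
    { toFun := fun x => ⟨x.1.1, x.2⟩
      map_add' := fun _ _ => rfl
      map_smul' := fun _ _ => rfl }
  refine hπ.exchange h1 (K.restrict G) (Submodule.ext fun x => (hk x).symm) (n := n)
    (ρ := ρ.comp r) (fun x => hρ (r x)) (f := ⟨Submodule.inclusion hle f, f.2⟩) hfe ?_
  exact hf.constantCoeff_ne_zero hρ hρs

/-- The top quotient is chosen with the largest possible exponent; the kernel, still cyclic, is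
filtered by induction. Only monotonicity at the junction needs an argument. -/
theorem Embeds.exists_isChain {l : ℚ} (hE : Embeds l E) (k : ℕ) : ∀ G : Sub E,
    Module.finrank ℂ⟦X⟧ G.carrier = k → (∃ e : G.carrier, IsGen e) →
    ∃ (F : Fin (k + 1) → Sub E) (μ : Fin k → ℝ), IsChain F μ ∧ F (Fin.last k) = G := by
  induction k with
  | zero =>
    exact fun G hG _ => ⟨fun _ => G, fun _ => 0, ⟨hE.carrier_eq_bot hG, fun j => j.elim0,
      fun j => j.elim0⟩, rfl⟩
  | succ k ih =>
    intro G hG hgen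
    classical
    have := (hE.sub G).finite
    obtain ⟨B, hB⟩ := hE.exists_bound _ G rfl
    let P : ℕ → Prop := fun n => ∃ π : G.carrier →ₗ[ℂ⟦X⟧] ℂ⟦X⟧, IsHom ((l : ℂ) + n) π ∧
      Function.Surjective π
    have hPB : ∀ n, P n → n ≤ B := by
      rintro n ⟨π, hπ, hs⟩
      refine hB n π hπ ?_
      rintro rfl
      obtain ⟨x, hx⟩ := hs 1
      simp at hx
    obtain ⟨n₀, hn₀⟩ := hE.exists_isHom_sub (G := G) (by omega)
    obtain ⟨π, hπ, hs⟩ := Nat.findGreatest_spec (P := P) (hPB n₀ hn₀) hn₀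
    set m := Nat.findGreatest P B
    have hmax : ∀ n, P n → n ≤ m := fun n hn => Nat.le_findGreatest (hPB n hn) hn
    have hst := step_kerSub hπ hs
    obtain ⟨F, μ, hF, hl⟩ := ih (kerSub G hπ) (by have := hst.finrank; omega)
      (hst.exists_isGen hgen)
    have hlast : ∀ j : Fin k, (j : ℕ) + 1 = k →
        μ j ≤ ((l : ℝ) + m) + 1 := by
      intro j hj
      have h1 := hF.step j
      rw [show j.succ = Fin.last k from Fin.ext hj, hl] at h1
      obtain ⟨-, ρ, hρ, hρs, -⟩ := id h1
      obtain ⟨m', hm'⟩ := (hE.sub _).exists_eq_add_nat hρ hρs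
      have hμ : μ j = (l : ℝ) + m' := by exact_mod_cast hm'
      by_contra hlt
      have hlt' : m + 1 < m' := by
        have : ((m + 1 : ℕ) : ℝ) < m' := by push_cast; linarith
        exact_mod_cast this
      -- Now `m' = m + n + 2`, and the exchange gives a quotient of `G` of exponent `l + m + n + 1`,
      -- above the maximum `l + m`.
      obtain ⟨n, rfl⟩ := Nat.exists_eq_add_of_lt hlt'
      have h2 : Step (F j.castSucc) (kerSub G hπ) ((l : ℂ) + m + (n + 1) + 1) := by
        have e : ((l : ℂ) + m + (n + 1) + 1) = (μ j : ℂ) := by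
          rw [hm']
          push_cast
          ring
        rwa [e]
      obtain ⟨ψ, hψ, hψs⟩ := h2.exchange hst hgen
      have := hmax (m + (n + 1)) ⟨ψ, by push_cast; rwa [← add_assoc], hψs⟩
      omega
    refine ⟨Fin.snoc F G, Fin.snoc μ ((l : ℝ) + m), ⟨?_, fun j => ?_, ?_⟩, Fin.snoc_last _ _⟩
    · have := hF.zero
      rwa [← Fin.castSucc_zero, Fin.snoc_castSucc]
    · induction j using Fin.lastCases with
      | last =>
        rw [Fin.succ_last, Fin.snoc_last, Fin.snoc_castSucc, Fin.snoc_last, hl]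
        push_cast
        exact hst
      | cast j =>
        rw [Fin.succ_castSucc, Fin.snoc_castSucc, Fin.snoc_castSucc, Fin.snoc_castSucc]
        exact hF.step j
    · rcases k with _ | k
      · intro i j _
        rw [Fin.fin_one_eq_zero i, Fin.fin_one_eq_zero j]
      refine Fin.monotone_iff_le_succ.2 fun j => ?_
      induction j using Fin.lastCases with
      | last =>
        have := hlast (Fin.last k) rfl
        rw [Fin.succ_last, Fin.snoc_last, Fin.snoc_castSucc]
        simp only [Fin.val_castSucc, Fin.val_last]
        push_cast
        linarith
      | cast j =>
        have := hF.mono (Fin.castSucc_le_succ j)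
        rw [Fin.succ_castSucc, Fin.snoc_castSucc, Fin.snoc_castSucc]
        exact this

end Existence

/-! ### Filtrations by functionals versus principal Jordan–Hölder sequences. -/

section Principal

variable {E : Type u} [AddCommGroup E] [Module ℂ⟦X⟧ E] [ABStructure E]

theorem Step.mem_of_X_smul_mem {F G : Sub E} {z : ℂ} (h : Step F G z) {x : E}
    (hx : x ∈ G.carrier) (hX : (X : ℂ⟦X⟧) • x ∈ F.carrier) : x ∈ F.carrier := by
  obtain ⟨-, π, -, -, hk⟩ := h
  have h1 := (hk ((X : ℂ⟦X⟧) • ⟨x, hx⟩)).2 hX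
  rw [map_smul, smul_eq_mul] at h1
  exact (hk ⟨x, hx⟩).1 ((mul_eq_zero.1 h1).resolve_left X_ne_zero)

theorem Sub.isNormal_of_mem {F : Sub E} (h : ∀ x, (X : ℂ⟦X⟧) • x ∈ F.carrier → x ∈ F.carrier) :
    F.IsNormal := by
  refine le_antisymm ?_ ?_
  · rintro _ ⟨hF, hX⟩
    obtain ⟨y, -, rfl⟩ := (Submodule.mem_smul_pointwise_iff_exists _ _ _).1 hX
    exact Submodule.smul_mem_pointwise_smul _ _ _ (h y hF)
  · intro x hx
    obtain ⟨y, hy, rfl⟩ := (Submodule.mem_smul_pointwise_iff_exists _ _ _).1 hx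
    exact ⟨F.carrier.smul_mem _ hy, Submodule.smul_mem_pointwise_smul _ _ _ trivial⟩

/-- Normality holds because `E / F_j` has no `b`-torsion, by descending induction on `j`: each `E_z`
is torsion-free. -/
theorem IsChain.isPrincipal {k : ℕ} {F : Fin (k + 1) → Sub E} {μ : Fin k → ℝ}
    (h : IsChain F μ) (hl : (F (Fin.last k)).carrier = ⊤) : IsPrincipal F := by
  have hinv : HasInvariants F (fun j => (μ j : ℂ)) := fun j =>
    (step_iff (h.step j).1).1 (h.step j)
  refine ⟨⟨h.zero, hl, fun j => (h.step j).1, fun j => Sub.isNormal_of_mem ?_, fun j => ?_⟩,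
    μ, hinv, h.mono⟩
  · induction j using Fin.reverseInduction with
    | last => simp [hl]
    | cast j ih =>
      exact fun x hx => (h.step j).mem_of_X_smul_mem (ih x ((h.step j).1 hx)) hx
  · obtain ⟨φ⟩ := hinv j
    rw [φ.toLinearEquiv.finrank_eq]
    exact Module.finrank_self ℂ⟦X⟧

theorem IsPrincipal.exists_isChain {k : ℕ} {F : Fin (k + 1) → Sub E} (h : IsPrincipal F) :
    ∃ μ : Fin k → ℝ, IsChain F μ := by
  obtain ⟨hJ, μ, hμ, hm⟩ := h
  exact ⟨μ, hJ.zero, fun j => (step_iff (hJ.le j)).2 (hμ j), hm⟩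

theorem Sub.exists_isGen_of_eq_top {G : Sub E} (hG : G.carrier = ⊤) (h : ∃ e : E, IsGen e) :
    ∃ e : G.carrier, IsGen e := by
  obtain ⟨e, he⟩ := h
  have hmem : ∀ x, x ∈ G.carrier := fun x => hG ▸ trivial
  refine ⟨⟨e, hmem e⟩, fun M hM ha => ?_⟩
  have := he (M.map G.carrier.subtype) ⟨_, hM, rfl⟩ (by
    rintro _ ⟨x, hx, rfl⟩
    exact ⟨a x, ha x hx, rfl⟩)
  refine eq_top_iff.2 fun x _ => ?_
  obtain ⟨y, hy, hyx⟩ := (this ▸ trivial : x.1 ∈ M.map G.carrier.subtype)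
  rwa [← show y = x from Subtype.ext hyx]

theorem IsPrincipal.unique {k : ℕ} {F F' : Fin (k + 1) → Sub E} (h : IsPrincipal F)
    (h' : IsPrincipal F') (hE : ∃ e : E, IsGen e) : F = F' := by
  obtain ⟨μ, hμ⟩ := h.exists_isChain
  obtain ⟨μ', hμ'⟩ := h'.exists_isChain
  exact hμ.unique hμ' (Sub.ext (h.1.last.trans h'.1.last.symm))
    (Sub.exists_isGen_of_eq_top h.1.last hE)

theorem Embeds.exists_isPrincipal {l : ℚ} (hE : Embeds l E) (hgen : ∃ e : E, IsGen e) {k : ℕ}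
    (hk : Module.finrank ℂ⟦X⟧ E = k) : ∃ F : Fin (k + 1) → Sub E, IsPrincipal F := by
  let T : Sub E := ⟨⊤, fun _ _ => trivial⟩
  obtain ⟨F, μ, hF, hl⟩ := hE.exists_isChain k T (by
    rw [← hk]
    exact LinearEquiv.finrank_eq Submodule.topEquiv) (Sub.exists_isGen_of_eq_top rfl hgen)
  exact ⟨F, hF.isPrincipal (by rw [hl])⟩

end Principal

/-! ### Transport by isomorphisms. -/

section Transport

variable {E : Type u} [AddCommGroup E] [Module ℂ⟦X⟧ E] [ABStructure E]
variable {E' : Type v} [AddCommGroup E'] [Module ℂ⟦X⟧ E'] [ABStructure E']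

/-- The isomorphism induced on subquotients. -/
theorem Iso.nonempty_subquotient (φ : Iso E E') (F G : Sub E) :
    Nonempty (Iso (Subquotient G F) (Subquotient (G.map φ) (F.map φ))) := by
  let g : G.carrier ≃ₗ[ℂ⟦X⟧] (G.map φ).carrier := φ.toLinearEquiv.submoduleMap G.carrier
  have hg : ∀ x, (g x).1 = φ.toLinearEquiv x.1 := fun _ => rfl
  refine ⟨⟨Submodule.Quotient.equiv _ _ g ?_, fun x => ?_⟩⟩
  · ext x
    constructor
    · rintro ⟨y, hy, rfl⟩
      exact ⟨y.1, hy, rfl⟩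
    · rintro ⟨y, hy, hyx⟩
      obtain ⟨x, rfl⟩ := g.surjective x
      have : y = x.1 := φ.toLinearEquiv.injective hyx
      refine ⟨x, ?_, rfl⟩
      change x.1 ∈ F.carrier
      rwa [← this]
  · obtain ⟨x, rfl⟩ := Submodule.Quotient.mk_surjective _ x
    exact congrArg (Submodule.Quotient.mk (p := ((F.map φ).restrict (G.map φ)).carrier))
      (Subtype.ext (φ.map_a x.1) : g (a x) = a (g x))

/-- The inverse isomorphism. -/
noncomputable def Iso.symm (φ : Iso E E') : Iso E' E where
  toLinearEquiv := φ.toLinearEquiv.symm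
  map_a x := φ.toLinearEquiv.injective (by rw [φ.map_a]; simp)

/-- The composition of isomorphisms. -/
noncomputable def Iso.trans {E'' : Type*} [AddCommGroup E''] [Module ℂ⟦X⟧ E''] [ABStructure E'']
    (φ : Iso E E') (ψ : Iso E' E'') : Iso E E'' where
  toLinearEquiv := φ.toLinearEquiv.trans ψ.toLinearEquiv
  map_a x := by simp [φ.map_a, ψ.map_a]

theorem hasInvariants_map_iff (φ : Iso E E') {k : ℕ} (F : Fin (k + 1) → Sub E) (μ : Fin k → ℂ) :
    HasInvariants (fun j => (F j).map φ) μ ↔ HasInvariants F μ := by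
  refine forall_congr' fun j => ?_
  obtain ⟨ψ⟩ := φ.nonempty_subquotient (F j.castSucc) (F j.succ)
  exact ⟨fun ⟨χ⟩ => ⟨ψ.trans χ⟩, fun ⟨χ⟩ => ⟨ψ.symm.trans χ⟩⟩

theorem IsPrincipal.map {k : ℕ} {F : Fin (k + 1) → Sub E} (h : IsPrincipal F) (φ : Iso E E') :
    IsPrincipal fun j => (F j).map φ := by
  obtain ⟨hJ, μ, hμ, hm⟩ := h
  have hle : ∀ j : Fin k, ((F j.castSucc).map φ).carrier ≤ ((F j.succ).map φ).carrier :=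
    fun j => Submodule.map_mono (hJ.le j)
  refine IsChain.isPrincipal (μ := μ) ⟨?_, fun j => ?_, hm⟩ ?_
  · change (F 0).carrier.map _ = ⊥
    rw [hJ.zero, Submodule.map_bot]
  · exact (step_iff (hle j)).2 ((hasInvariants_map_iff φ F _).2 hμ j)
  · change (F (Fin.last k)).carrier.map _ = ⊤
    rw [hJ.last, Submodule.map_top]
    exact LinearEquiv.range φ.toLinearEquiv

theorem IsGen.map {e : E} (he : IsGen e) (φ : Iso E E') : IsGen (φ.toLinearEquiv e) := by
  intro M hM ha
  have := he (M.comap (φ.toLinearEquiv : E →ₗ[ℂ⟦X⟧] E')) hM fun x hx => by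
    change φ.toLinearEquiv (a x) ∈ M
    rw [φ.map_a]
    exact ha _ hx
  refine eq_top_iff.2 fun x _ => ?_
  have h := (this ▸ trivial : φ.toLinearEquiv.symm x ∈ M.comap (φ.toLinearEquiv : E →ₗ[ℂ⟦X⟧] E'))
  rw [Submodule.mem_comap] at h
  simpa using h

end Transport

end ABStructure

/-! ### The main theorem. -/

open ABStructure in
theorem mainTheorem1 (l : ℚ) (hl0 : 0 < l) (hl1 : l ≤ 1)
    {E : Type u} [AddCommGroup E] [Module ℂ⟦X⟧ E] [ABStructure E]
    (hE : ABStructure.IsFresco E) (hprim : ABStructure.IsPrimitive E l)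
    (k : ℕ) (hk : Module.finrank ℂ⟦X⟧ E = k) :
    (∃! F : Fin (k + 1) → ABStructure.Sub E, ABStructure.IsPrincipal F) ∧
    ∀ F : Fin (k + 1) → ABStructure.Sub E, ABStructure.IsPrincipal F →
      (∃! μ : Fin k → ℂ, ABStructure.HasInvariants F μ) ∧
      (∀ μ : Fin k → ℂ, ABStructure.HasInvariants F μ →
        ∀ j, ∃ n : ℕ, μ j = (l : ℂ) + (n : ℂ)) ∧
      ∀ {E' : Type v} [AddCommGroup E'] [Module ℂ⟦X⟧ E'] [ABStructure E']
        (φ : ABStructure.Iso E E') (F' : Fin (k + 1) → ABStructure.Sub E'),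
        (ABStructure.IsPrincipal F' ↔ ∀ j, F' j = (F j).map φ) ∧
        (ABStructure.IsPrincipal F' →
          (∀ μ : Fin k → ℂ, ABStructure.HasInvariants F' μ ↔ ABStructure.HasInvariants F μ) ∧
          ∀ i j : Fin (k + 1), i ≤ j →
            Nonempty (ABStructure.Iso (ABStructure.Subquotient (F j) (F i))
              (ABStructure.Subquotient (F' j) (F' i)))) := by
  have hemb := hE.embeds hl0 hl1 hprim
  have hgen := hE.exists_isGen
  obtain ⟨F₀, hF₀⟩ := hemb.exists_isPrincipal hgen hk
  refine ⟨⟨F₀, hF₀, fun F hF => hF.unique hF₀ hgen⟩, fun F hF => ⟨?_, fun μ hμ j => ?_, ?_⟩⟩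
  · obtain ⟨μ, hμ, -⟩ := hF.2
    refine ⟨_, hμ, fun μ' hμ' => funext fun j => ?_⟩
    have hle := hF.1.le j
    exact ((step_iff hle).2 (hμ' j)).unique ((step_iff hle).2 (hμ j))
  · obtain ⟨-, π, hπ, hs, -⟩ := (step_iff (hF.1.le j)).2 (hμ j)
    exact (hemb.sub _).exists_eq_add_nat hπ hs
  · intro E' _ _ _ φ F'
    -- Uniqueness rests on cyclicity alone, which `φ` carries to `E'`.
    have hgen' : ∃ e : E', IsGen e := hgen.imp' _ fun e he => he.map φ
    have heq : IsPrincipal F' → F' = fun j => (F j).map φ := fun h => h.unique (hF.map φ) hgen'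
    refine ⟨⟨fun h j => congrFun (heq h) j, fun h => ?_⟩, fun h => ?_⟩
    · rw [funext h]
      exact hF.map φ
    · rw [heq h]
      exact ⟨hasInvariants_map_iff φ F, fun i j _ => φ.nonempty_subquotient (F i) (F j)⟩
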